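/- Let $\Gamma$ be a countable group acting by Borel automorphisms on a standard Borel space $B$, and let $\nu$ be a Borel probability measure on $B$ such that the action $\Gamma\curvearrowright(B,\nu)$ is nonsingular (that is, $\nu$ is $\Gamma$-quasi-invariant). For a $\Gamma$-quasi-invariant probability measure $\eta$ on $B$ and $g\in\Gamma$ write $(\eta\circ g)(A)=\eta(gA)$. The ratio set $RS(\Gamma\curvearrowright(B,\eta))\subset[0,\infty]$ is defined as follows. A real number $r\ge 0$ belongs to it if and only if for every measurable $A\subset B$ with $\eta(A)>0$ and every $\epsilon>0$ there are a measurable $A'\subset A$ with $\eta(A')>0$ and $g\in\Gamma\setminus\{e\}$ such that $gA'\subset A$ and $\left|\frac{d\eta\circ g}{d\eta}(b)-r\right|<\epsilon$ for every $b\in A'$. The element $+\infty$ belongs to it if and only if for every measurable $A\subset B$ with $\eta(A)>0$ and every $n>0$ there are a measurable $A'\subset A$ with $\eta(A')>0$ and $g\in\Gamma\setminus\{e\}$ such that $gA'\subset A$ and $\frac{d\eta\circ g}{d\eta}(b)>n$ for every $b\in A'$. Let $\alpha:\Gamma\times B\to\mathbb{R}_{>0}$ be a Borel map with $\alpha(g_2,g_1b)\,\alpha(g_1,b)=\alpha(g_2g_1,b)$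 for all $g_1,g_2\in\Gamma$ and all $b\in B$, such that for every $g\in\Gamma$, $\alpha(g,b)=\frac{d\nu\circ g}{d\nu}(b)$ for $\nu$-a.e. $b$. Let $\omega$ be an ergodic decomposition of $\nu$ relative to $\alpha$: a probability measure on the space of ergodic $\Gamma$-quasi-invariant probability measures on $B$ such that $\nu=\int\eta\,d\omega(\eta)$ and, for $\omega$-a.e. $\eta$ and every $g\in\Gamma$, $\alpha(g,b)=\frac{d\eta\circ g}{d\eta}(b)$ for $\eta$-a.e. $b\in B$. Then for every $t\in[0,\infty]$, $$t\in RS(\Gamma\curvearrowright(B,\nu))\iff t\in RS(\Gamma\curvearrowright(B,\eta))\ \text{ for } \omega\text{-a.e. } \eta .$$ -/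

import Mathlib

open MeasureTheory
open scoped ENNReal

namespace RatioSet

variable {Γ B : Type*} [Group Γ] [MulAction Γ B] [MeasurableSpace B]

/-- The action of `Γ` on `(B, ν)` is nonsingular, i.e. `ν` is `Γ`-quasi-invariant: every `g`
(hence also `g⁻¹`) pushes `ν` to a measure absolutely continuous with respect to `ν`. -/
def IsQuasiInvariant (Γ : Type*) {B : Type*} [Group Γ] [MulAction Γ B] [MeasurableSpace B]
    (ν : Measure B) : Prop :=
  ∀ g : Γ, ν.map (fun b => g • b) ≪ ν

/-- Ergodicity: every `Γ`-invariant measurable set is null or conull. -/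
def IsErgodic (Γ : Type*) {B : Type*} [Group Γ] [MulAction Γ B] [MeasurableSpace B]
    (ν : Measure B) : Prop :=
  ∀ A : Set B, MeasurableSet A → (∀ g : Γ, (fun b => g • b) ⁻¹' A = A) → ν A = 0 ∨ ν Aᶜ = 0

/-- The measure `ν ∘ g`, `(ν ∘ g) A = ν (g A)`: the push-forward of `ν` under `g⁻¹`. -/
noncomputable def translate (ν : Measure B) (g : Γ) : Measure B :=
  ν.map (fun b => g⁻¹ • b)

/-- `(ν ∘ g) A = ν (g A)`. -/
theorem translate_apply [MeasurableConstSMul Γ B] (ν : Measure B) (g : Γ) {A : Set B}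
    (hA : MeasurableSet A) : translate ν g A = ν ((fun b => g • b) '' A) := by
  rw [translate, Measure.map_apply (measurable_const_smul g⁻¹) hA]
  congr 1
  ext b
  simp only [Set.mem_preimage, Set.mem_image]
  constructor
  · intro h
    exact ⟨g⁻¹ • b, h, smul_inv_smul g b⟩
  · rintro ⟨a, ha, rfl⟩
    simpa using ha

/-- The Radon-Nikodym derivative `d(ν ∘ g)/dν`. -/
noncomputable def rnDerivative (ν : Measure B) (g : Γ) (b : B) : ℝ≥0∞ :=
  (translate ν g).rnDeriv ν b

/-- A real number `r` is an asymptotic ratio of the action on `(B, ν)`. -/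
def IsFiniteRatio (Γ : Type*) {B : Type*} [Group Γ] [MulAction Γ B] [MeasurableSpace B]
    (ν : Measure B) (r : ℝ) : Prop :=
  ∀ A : Set B, MeasurableSet A → 0 < ν A → ∀ ε : ℝ, 0 < ε →
    ∃ A' ⊆ A, MeasurableSet A' ∧ 0 < ν A' ∧ ∃ g : Γ, g ≠ 1 ∧
      (fun b => g • b) '' A' ⊆ A ∧ ∀ b ∈ A', |(rnDerivative ν g b).toReal - r| < ε

/-- `+∞` is an asymptotic ratio of the action on `(B, ν)`. -/
def IsInfiniteRatio (Γ : Type*) {B : Type*} [Group Γ] [MulAction Γ B] [MeasurableSpace B]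
    (ν : Measure B) : Prop :=
  ∀ A : Set B, MeasurableSet A → 0 < ν A → ∀ n : ℝ, 0 < n →
    ∃ A' ⊆ A, MeasurableSet A' ∧ 0 < ν A' ∧ ∃ g : Γ, g ≠ 1 ∧
      (fun b => g • b) '' A' ⊆ A ∧ ∀ b ∈ A', ENNReal.ofReal n < rnDerivative ν g b

/-- The ratio set of the action of `Γ` on `(B, ν)`, a subset of `[0, ∞]`. -/
def ratioSet (Γ : Type*) {B : Type*} [Group Γ] [MulAction Γ B] [MeasurableSpace B]
    (ν : Measure B) : Set ℝ≥0∞ :=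
  {t | (t ≠ ∞ ∧ IsFiniteRatio Γ ν t.toReal) ∨ (t = ∞ ∧ IsInfiniteRatio Γ ν)}

/-- `α` agrees almost everywhere with the Radon-Nikodym derivatives of the measure `ν`. -/
def AgreesWithRN (ν : Measure B) (α : Γ → B → ℝ) : Prop :=
  ∀ g : Γ, ∀ᵐ b ∂ν, rnDerivative ν g b = ENNReal.ofReal (α g b)

/-- `α` is a Borel cocycle `Γ × B → ℝ_{>0}`, with the cocycle identity holding everywhere, which is
a version of the Radon-Nikodym cocycle of `(B, ν)`. -/
structure IsRNCocycle (ν : Measure B) (α : Γ → B → ℝ) : Prop where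
  measurable : ∀ g, Measurable (α g)
  pos : ∀ g b, 0 < α g b
  cocycle : ∀ g₁ g₂ b, α g₂ (g₁ • b) * α g₁ b = α (g₂ * g₁) b
  agrees : AgreesWithRN ν α

/-- `ω` is an ergodic decomposition of `ν` relative to the version `α` of the Radon-Nikodym cocycle:
a probability measure, carried by the ergodic `Γ`-quasi-invariant probability measures on `B`
(the space `Measure B` has the `σ`-algebra generated by the evaluations `η ↦ η A`),
with `ν = ∫ η dω(η)`, almost all of whose components have `α` as Radon-Nikodym cocycle. -/
structure IsErgodicDecomposition (ν : Measure B) (α : Γ → B → ℝ) (ω : Measure (Measure B)) :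
    Prop where
  isProbabilityMeasure : IsProbabilityMeasure ω
  ergodic : ∀ᵐ η ∂ω, IsProbabilityMeasure η ∧ IsQuasiInvariant Γ η ∧ IsErgodic Γ η
  barycenter : ∀ A : Set B, MeasurableSet A → ν A = ∫⁻ η, η A ∂ω
  agrees : ∀ᵐ η ∂ω, AgreesWithRN η α

end RatioSet

/-! Since `α` is defined at every point, the absence of nontrivial returns to a set `A` with cocycle
value in `U` (lacunarity) is a pointwise condition not mentioning any measure. Membership in a ratio
set says that, for suitable `U`, all measurable lacunary sets are null. A set that is null for
almost every component is null for the mixture, which gives one direction. The converse is the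
difficulty: a component may have its own non-null lacunary set, and these must be controlled
simultaneously.

For `0 < t < ∞` take `U` within `[c, C] ⊂ (0, ∞)`. For each `A` in a countable generating algebra,
match points of `A` greedily by returns with values in `U`. The leftover is lacunary, hence null for
the mixture and so for almost every component, for all these `A` at once. A lacunary `E` contains no
matched pair, so the bounds on `U` give `η A ≤ K * η (A \ E)` (`measure_le_of_isLacunary`).
Approximating `E` by `A` forces `η E = 0` (`isRecurrent_of_exhausted`).

Inverting group elements exchanges `t = 0` with `t = ∞`, so only `∞` remains; there `U` is unbounded
and `K` is lost. If an ergodic component is not recurrent for `(n, ∞)`, its cocycle is a coboundary: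
`L (g • b) = L b - log α(g, b)` (`exists_coboundary`). The point is to find one Borel `M` that
serves all such components (`exists_ae_coboundary`). On the skew product `B × ℝ`, projections onto
invariant functions computed for the mixture are also projections for almost every component
(`exists_ae_invariant_projection`). On a coboundary component they reveal the distribution of `y +
L` along the fibre `x = y + L b`, and its median singles out a point `y₀ + L b`, which is `M b`.
Where `M` satisfies the coboundary equation, its unit level slices are lacunary for `(e, ∞)`. Thus
recurrence of the mixture makes that set null, and almost no component is bad. -/

namespace RatioSet

open Set Filter Topology

/-! ### Ratio sets in terms of null lacunary sets -/

section Recurrence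

variable {Γ B : Type*} [Group Γ] [MulAction Γ B]

/-- No nontrivial group element moves a point of `A` into `A` with cocycle value in `U`. -/
def IsLacunary (α : Γ → B → ℝ) (U : Set ℝ) (A : Set B) : Prop :=
  ∀ b ∈ A, ∀ g : Γ, g ≠ 1 → g • b ∈ A → α g b ∉ U

theorem IsLacunary.mono {α : Γ → B → ℝ} {U V : Set ℝ} {A : Set B} (h : IsLacunary α V A)
    (hUV : U ⊆ V) : IsLacunary α U A :=
  fun b hb g hg hgb hU => h b hb g hg hgb (hUV hU)

theorem cocycle_one {α : Γ → B → ℝ} (hpos : ∀ g b, 0 < α g b)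
    (hcoc : ∀ g₁ g₂ b, α g₂ (g₁ • b) * α g₁ b = α (g₂ * g₁) b) (b : B) : α 1 b = 1 := by
  have h := hcoc 1 1 b
  rw [one_smul, mul_one] at h
  exact mul_right_cancel₀ (hpos 1 b).ne' (h.trans (one_mul _).symm)

theorem cocycle_inv_mul {α : Γ → B → ℝ} (hpos : ∀ g b, 0 < α g b)
    (hcoc : ∀ g₁ g₂ b, α g₂ (g₁ • b) * α g₁ b = α (g₂ * g₁) b) (g : Γ) (b : B) :
    α g⁻¹ (g • b) * α g b = 1 := by
  rw [hcoc, inv_mul_cancel, cocycle_one hpos hcoc]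

theorem cocycle_inv {α : Γ → B → ℝ} (hpos : ∀ g b, 0 < α g b)
    (hcoc : ∀ g₁ g₂ b, α g₂ (g₁ • b) * α g₁ b = α (g₂ * g₁) b) (g : Γ) (b : B) :
    α g⁻¹ (g • b) = (α g b)⁻¹ :=
  eq_inv_of_mul_eq_one_left (cocycle_inv_mul hpos hcoc g b)

variable [MeasurableSpace B]

/-- Every measurable `U`-lacunary set is null. -/
def IsRecurrent (η : Measure B) (α : Γ → B → ℝ) (U : Set ℝ) : Prop :=
  ∀ A : Set B, MeasurableSet A → IsLacunary α U A → η A = 0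

theorem IsRecurrent.mono {η : Measure B} {α : Γ → B → ℝ} {U V : Set ℝ} (h : IsRecurrent η α U)
    (hUV : U ⊆ V) : IsRecurrent η α V :=
  fun A hA hl => h A hA (hl.mono hUV)

/-- The part of `A` which `g` moves into `A` with cocycle value in `U`. -/
def returnSet (α : Γ → B → ℝ) (U : Set ℝ) (A : Set B) (g : Γ) : Set B :=
  {b | b ∈ A ∧ g • b ∈ A ∧ α g b ∈ U}

theorem measurableSet_returnSet [MeasurableConstSMul Γ B] {α : Γ → B → ℝ}
    (hα : ∀ g, Measurable (α g)) {U : Set ℝ} (hU : MeasurableSet U) {A : Set B}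
    (hA : MeasurableSet A) (g : Γ) : MeasurableSet (returnSet α U A g) :=
  hA.inter ((measurable_const_smul g hA).inter (hα g hU))

/-- Removing from `A` all its return sets leaves a lacunary set. If that is null, countability of
`Γ` makes some return set non-null. `P` covers the finite and infinite cases together. -/
theorem forall_exists_return_iff_isRecurrent [Countable Γ] [MeasurableConstSMul Γ B]
    {η : Measure B} {α : Γ → B → ℝ} (hα : ∀ g, Measurable (α g)) (hpos : ∀ g b, 0 < α g b)
    (hη : AgreesWithRN η α) {U : Set ℝ} (hU : MeasurableSet U) {P : ℝ≥0∞ → Prop}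
    (hP : ∀ a : ℝ, 0 < a → (P (ENNReal.ofReal a) ↔ a ∈ U)) :
    (∀ A : Set B, MeasurableSet A → 0 < η A → ∃ A' ⊆ A, MeasurableSet A' ∧ 0 < η A' ∧
      ∃ g : Γ, g ≠ 1 ∧ (fun b => g • b) '' A' ⊆ A ∧ ∀ b ∈ A', P (rnDerivative η g b)) ↔
      IsRecurrent η α U := by
  constructor
  · intro h A hA hl
    by_contra hne
    obtain ⟨A', hsub, -, hpos', g, hg, himg, hAP⟩ := h A hA (pos_iff_ne_zero.mpr hne)
    have hfreq : ∃ᵐ b ∂η, b ∈ A' := frequently_ae_mem_iff.mpr hpos'.ne'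
    obtain ⟨b, hb, hrn⟩ := (hfreq.and_eventually (hη g)).exists
    refine hl b (hsub hb) g hg (himg ⟨b, hb, rfl⟩) ?_
    rw [← hP _ (hpos g b), ← hrn]
    exact hAP b hb
  · intro h A hA hApos
    have hmeas := fun g : Γ => measurableSet_returnSet hα hU hA g
    have hunion : MeasurableSet (⋃ g : {g : Γ // g ≠ 1}, returnSet α U A g) :=
      MeasurableSet.iUnion fun g => hmeas g
    have hnull : η (A \ ⋃ g : {g : Γ // g ≠ 1}, returnSet α U A g) = 0 := by
      refine h _ (hA.diff hunion) ?_
      intro b hb g hg hgb hUb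
      exact hb.2 (mem_iUnion.mpr ⟨⟨g, hg⟩, hb.1, hgb.1, hUb⟩)
    have hex : ∃ g : {g : Γ // g ≠ 1}, η (returnSet α U A g) ≠ 0 := by
      by_contra! hzero
      have : η (⋃ g : {g : Γ // g ≠ 1}, returnSet α U A g) = 0 := measure_iUnion_null hzero
      exact hApos.ne' (measure_mono_null (by rw [sdiff_union_self]; exact subset_union_left)
        (measure_union_null hnull this))
    obtain ⟨⟨g, hg⟩, hgpos⟩ := hex
    -- The ratio condition is required at every point of `A'`, so `A'` must be cut down to where the
    -- derivative equals `α`.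
    have hrnm : MeasurableSet {b | rnDerivative η g b = ENNReal.ofReal (α g b)} :=
      measurableSet_eq_fun (Measure.measurable_rnDeriv _ _) (hα g).ennreal_ofReal
    refine ⟨returnSet α U A g ∩ {b | rnDerivative η g b = ENNReal.ofReal (α g b)},
      fun b hb => hb.1.1, (hmeas g).inter hrnm, ?_, g, hg, ?_, ?_⟩
    · rw [measure_inter_conull (hη g)]
      exact pos_iff_ne_zero.mpr hgpos
    · rintro _ ⟨b, hb, rfl⟩
      exact hb.1.2.1
    · intro b hb
      rw [hb.2, hP _ (hpos g b)]
      exact hb.1.2.2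

theorem isFiniteRatio_iff_isRecurrent [Countable Γ] [MeasurableConstSMul Γ B]
    {η : Measure B} {α : Γ → B → ℝ} (hα : ∀ g, Measurable (α g)) (hpos : ∀ g b, 0 < α g b)
    (hη : AgreesWithRN η α) (r : ℝ) :
    IsFiniteRatio Γ η r ↔ ∀ ε : ℝ, 0 < ε → IsRecurrent η α {a | |a - r| < ε} := by
  have key := fun ε : ℝ => forall_exists_return_iff_isRecurrent hα hpos hη
    (U := {a | |a - r| < ε}) (P := fun x => |x.toReal - r| < ε)
    (measurableSet_lt (by fun_prop) measurable_const)
    (fun a ha => by simp [ENNReal.toReal_ofReal ha.le])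
  constructor
  · intro h ε hε
    exact (key ε).mp fun A hA hpos' => h A hA hpos' ε hε
  · intro h A hA hpos' ε hε
    exact (key ε).mpr (h ε hε) A hA hpos'

theorem isInfiniteRatio_iff_isRecurrent [Countable Γ] [MeasurableConstSMul Γ B]
    {η : Measure B} {α : Γ → B → ℝ} (hα : ∀ g, Measurable (α g)) (hpos : ∀ g b, 0 < α g b)
    (hη : AgreesWithRN η α) :
    IsInfiniteRatio Γ η ↔ ∀ n : ℝ, 0 < n → IsRecurrent η α (Ioi n) := by
  have key := fun n : ℝ => forall_exists_return_iff_isRecurrent hα hpos hη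
    (U := Ioi n) (P := fun x => ENNReal.ofReal n < x) measurableSet_Ioi
    (fun a ha => by rw [ENNReal.ofReal_lt_ofReal_iff ha, mem_Ioi])
  constructor
  · intro h n hn
    exact (key n).mp fun A hA hpos' => h A hA hpos' n hn
  · intro h A hA hpos' n hn
    exact (key n).mpr (h n hn) A hA hpos'

/-- Passing from a return to its inverse exchanges small and large cocycle values. -/
theorem isRecurrent_abs_lt_iff {η : Measure B} {α : Γ → B → ℝ} (hpos : ∀ g b, 0 < α g b)
    (hcoc : ∀ g₁ g₂ b, α g₂ (g₁ • b) * α g₁ b = α (g₂ * g₁) b) {n : ℝ} (hn : 0 < n) :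
    IsRecurrent η α {a | |a - 0| < n⁻¹} ↔ IsRecurrent η α (Ioi n) := by
  have hiff : ∀ A : Set B, IsLacunary α {a | |a - 0| < n⁻¹} A ↔ IsLacunary α (Ioi n) A := by
    intro A
    constructor
    · intro h b hb g hg hgb hlt
      refine h (g • b) hgb g⁻¹ (inv_ne_one.mpr hg) (by rwa [inv_smul_smul]) ?_
      rw [mem_ofPred_eq, cocycle_inv hpos hcoc, sub_zero, abs_of_pos (inv_pos.mpr (hpos g b))]
      exact inv_strictAnti₀ hn hlt
    · intro h b hb g hg hgb hlt
      refine h (g • b) hgb g⁻¹ (inv_ne_one.mpr hg) (by rwa [inv_smul_smul]) ?_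
      rw [mem_ofPred_eq, sub_zero, abs_of_pos (hpos g b)] at hlt
      rw [mem_Ioi, cocycle_inv hpos hcoc]
      exact (lt_inv_comm₀ hn (hpos g b)).mpr hlt
  exact forall₂_congr fun A _ => by rw [hiff]

theorem isFiniteRatio_zero_iff_isInfiniteRatio [Countable Γ] [MeasurableConstSMul Γ B]
    {η : Measure B} {α : Γ → B → ℝ} (hα : ∀ g, Measurable (α g)) (hpos : ∀ g b, 0 < α g b)
    (hcoc : ∀ g₁ g₂ b, α g₂ (g₁ • b) * α g₁ b = α (g₂ * g₁) b)
    (hη : AgreesWithRN η α) : IsFiniteRatio Γ η 0 ↔ IsInfiniteRatio Γ η := by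
  rw [isFiniteRatio_iff_isRecurrent hα hpos hη, isInfiniteRatio_iff_isRecurrent hα hpos hη]
  constructor
  · intro h n hn
    exact (isRecurrent_abs_lt_iff hpos hcoc hn).mp (h _ (inv_pos.mpr hn))
  · intro h ε hε
    have := (isRecurrent_abs_lt_iff (η := η) hpos hcoc (inv_pos.mpr hε)).mpr
      (h _ (inv_pos.mpr hε))
    rwa [inv_inv] at this

end Recurrence

/-! ### Change of variables with the cocycle as density -/

section ChangeOfVariables

variable {Γ B : Type*} [Group Γ] [MulAction Γ B] [MeasurableSpace B] [MeasurableConstSMul Γ B]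

theorem lintegral_cocycle_mul_smul {η : Measure B} [IsFiniteMeasure η]
    (hq : IsQuasiInvariant Γ η) {α : Γ → B → ℝ} (hη : AgreesWithRN η α) (g : Γ)
    {F : B → ℝ≥0∞} (hF : Measurable F) :
    ∫⁻ b, ENNReal.ofReal (α g b) * F (g • b) ∂η = ∫⁻ b, F b ∂η := by
  have hac : translate η g ≪ η := hq g⁻¹
  have hFg : Measurable fun b => F (g • b) := hF.comp (measurable_const_smul g)
  have hfin : IsFiniteMeasure (translate η g) := by unfold translate; infer_instance
  calc ∫⁻ b, ENNReal.ofReal (α g b) * F (g • b) ∂η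
      = ∫⁻ b, (translate η g).rnDeriv η b * F (g • b) ∂η := by
        refine lintegral_congr_ae ((hη g).mono fun b hb => ?_)
        simp only
        rw [← hb]; rfl
    _ = ∫⁻ b, F (g • b) ∂(translate η g) := by
        rw [lintegral_rnDeriv_mul hac hFg.aemeasurable]
    _ = ∫⁻ b, F b ∂η := by
        rw [translate, lintegral_map hFg (measurable_const_smul _)]
        simp

end ChangeOfVariables

/-! ### Greedy matching by returns -/

section Matching

variable {Γ B : Type*} [Group Γ] [MulAction Γ B]

/-- Greedy construction of a partial injection of `A`, going through the sequence `e` of group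
elements: the `n`-th value is the pair of the domain and the range after `n` steps. -/
def greedyMatching (α : Γ → B → ℝ) (U : Set ℝ) (A : Set B) (e : ℕ → Γ) : ℕ → Set B × Set B
  | 0 => (∅, ∅)
  | n + 1 =>
    let P := (greedyMatching α U A e n).1
    let Q := (greedyMatching α U A e n).2
    let D := {b | (b ∈ A ∧ b ∉ P) ∧ (e n • b ∈ A ∧ e n • b ∉ Q) ∧ α (e n) b ∈ U ∧ e n ≠ 1}
    (P ∪ D, Q ∪ {b | (e n)⁻¹ • b ∈ D})

/-- The part of the domain of the greedy matching which is added in the `n`-th step. -/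
def greedyStep (α : Γ → B → ℝ) (U : Set ℝ) (A : Set B) (e : ℕ → Γ) (n : ℕ) : Set B :=
  {b | (b ∈ A ∧ b ∉ (greedyMatching α U A e n).1) ∧
    (e n • b ∈ A ∧ e n • b ∉ (greedyMatching α U A e n).2) ∧ α (e n) b ∈ U ∧ e n ≠ 1}

variable {α : Γ → B → ℝ} {U : Set ℝ} {A : Set B} {e : ℕ → Γ}

theorem greedyMatching_succ_fst (n : ℕ) : (greedyMatching α U A e (n + 1)).1 =
    (greedyMatching α U A e n).1 ∪ greedyStep α U A e n := rfl

theorem greedyMatching_succ_snd (n : ℕ) : (greedyMatching α U A e (n + 1)).2 =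
    (greedyMatching α U A e n).2 ∪ {b | (e n)⁻¹ • b ∈ greedyStep α U A e n} := rfl

theorem measurableSet_greedyMatching [MeasurableSpace B] [MeasurableConstSMul Γ B]
    (hα : ∀ g, Measurable (α g)) (hU : MeasurableSet U) (hA : MeasurableSet A) (n : ℕ) :
    MeasurableSet (greedyMatching α U A e n).1 ∧ MeasurableSet (greedyMatching α U A e n).2 ∧
      MeasurableSet (greedyStep α U A e n) := by
  have step : ∀ n, MeasurableSet (greedyMatching α U A e n).1 →
      MeasurableSet (greedyMatching α U A e n).2 → MeasurableSet (greedyStep α U A e n) := by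
    intro n h1 h2
    exact (hA.inter h1.compl).inter ((measurable_const_smul (e n) (hA.inter h2.compl)).inter
      ((hα (e n) hU).inter (MeasurableSet.const _)))
  induction n with
  | zero => exact ⟨.empty, .empty, step 0 .empty .empty⟩
  | succ n ih =>
    have h1 := ih.1.union ih.2.2
    have h2 := ih.2.1.union (measurable_const_smul (e n)⁻¹ ih.2.2)
    exact ⟨h1, h2, step (n + 1) h1 h2⟩

theorem greedyMatching_fst (n : ℕ) :
    (greedyMatching α U A e n).1 = ⋃ k < n, greedyStep α U A e k := by
  induction n with
  | zero => simp [greedyMatching]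
  | succ n ih => rw [greedyMatching_succ_fst, ih, biUnion_lt_succ]

theorem greedyMatching_snd (n : ℕ) : (greedyMatching α U A e n).2 =
    ⋃ k < n, {b | (e k)⁻¹ • b ∈ greedyStep α U A e k} := by
  induction n with
  | zero => simp [greedyMatching]
  | succ n ih => rw [greedyMatching_succ_snd, ih, biUnion_lt_succ]

theorem disjoint_range_greedyStep :
    Pairwise (Function.onFun Disjoint fun n => {b | (e n)⁻¹ • b ∈ greedyStep α U A e n}) := by
  refine (pairwise_disjoint_on _).mpr fun m n hmn => ?_
  rw [Set.disjoint_left]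
  intro b hm hn
  refine hn.2.1.2 ?_
  rw [greedyMatching_snd, smul_inv_smul]
  exact mem_biUnion (show m ∈ {k | k < n} from hmn) hm

/-- What the greedy matching leaves over is lacunary. -/
theorem isLacunary_sdiff_greedyStep (he : Function.Surjective e) :
    IsLacunary α U (A \ ((⋃ n, greedyStep α U A e n) ∪
      ⋃ n, {b | (e n)⁻¹ • b ∈ greedyStep α U A e n})) := by
  intro b hb g hg hgb hU
  obtain ⟨n, rfl⟩ := he g
  refine hb.2 (Or.inl (mem_iUnion.mpr ⟨n, ⟨hb.1, fun h => hb.2 (Or.inl ?_)⟩,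
    ⟨hgb.1, fun h => hgb.2 (Or.inr ?_)⟩, hU, hg⟩))
  · rw [greedyMatching_fst] at h
    exact iUnion₂_subset (fun k _ => subset_iUnion _ k) h
  · rw [greedyMatching_snd] at h
    exact iUnion₂_subset
      (fun k _ => subset_iUnion (fun n => {b | (e n)⁻¹ • b ∈ greedyStep α U A e n}) k) h

theorem disjoint_greedyStep : Pairwise (Function.onFun Disjoint (greedyStep α U A e)) := by
  refine (pairwise_disjoint_on _).mpr fun m n hmn => ?_
  rw [Set.disjoint_left]
  intro b hm hn
  refine hn.1.2 ?_
  rw [greedyMatching_fst]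
  exact mem_biUnion (show m ∈ {k | k < n} from hmn) hm

end Matching

/-! ### Testing recurrence on a dense family of sets -/

section Approximation

variable {Γ B : Type*} [Group Γ] [MulAction Γ B] [MeasurableSpace B] [MeasurableConstSMul Γ B]
  {α : Γ → B → ℝ} {η : Measure B} [IsFiniteMeasure η]

theorem setLIntegral_cocycle (hq : IsQuasiInvariant Γ η) (hη : AgreesWithRN η α) (g : Γ)
    {D : Set B} (hD : MeasurableSet D) :
    ∫⁻ b in {b | g • b ∈ D}, ENNReal.ofReal (α g b) ∂η = η D := by
  have h := lintegral_cocycle_mul_smul hq hη g (measurable_one.indicator hD)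
  rw [lintegral_indicator_one hD] at h
  rw [← h, ← lintegral_indicator (s := {b | g • b ∈ D}) (measurable_const_smul g hD)]
  congr 1 with b
  by_cases hb : g • b ∈ D <;> simp [hb]

theorem measure_smul_le (hq : IsQuasiInvariant Γ η) (hη : AgreesWithRN η α) (g : Γ)
    {D : Set B} (hD : MeasurableSet D) {C : ℝ} (hC : ∀ b ∈ D, α g b ≤ C) :
    η {b | g⁻¹ • b ∈ D} ≤ ENNReal.ofReal C * η D := by
  rw [← setLIntegral_cocycle hq hη g (D := {b | g⁻¹ • b ∈ D}) (measurable_const_smul g⁻¹ hD)]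
  simp only [mem_ofPred_eq, inv_smul_smul, ofPred_mem_eq]
  calc _ ≤ ∫⁻ _ in D, ENNReal.ofReal C ∂η :=
        setLIntegral_mono measurable_const fun b hb => ENNReal.ofReal_le_ofReal (hC b hb)
    _ = _ := setLIntegral_const D _

theorem mul_measure_le_measure_smul (hq : IsQuasiInvariant Γ η) (hη : AgreesWithRN η α) (g : Γ)
    {D : Set B} (hD : MeasurableSet D) (hαm : Measurable (α g)) {c : ℝ}
    (hc : ∀ b ∈ D, c ≤ α g b) :
    ENNReal.ofReal c * η D ≤ η {b | g⁻¹ • b ∈ D} := by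
  rw [← setLIntegral_cocycle hq hη g (D := {b | g⁻¹ • b ∈ D}) (measurable_const_smul g⁻¹ hD)]
  simp only [mem_ofPred_eq, inv_smul_smul, ofPred_mem_eq]
  calc _ = ∫⁻ _ in D, ENNReal.ofReal c ∂η := (setLIntegral_const D _).symm
    _ ≤ _ := setLIntegral_mono hαm.ennreal_ofReal fun b hb => ENNReal.ofReal_le_ofReal (hc b hb)

/-- If the greedy matching of `A` exhausts `A`, then `A` is not much larger than its part outside
a lacunary set. -/
theorem measure_le_of_isLacunary (hα : ∀ g, Measurable (α g)) (hq : IsQuasiInvariant Γ η)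
    (hη : AgreesWithRN η α) {U : Set ℝ} (hU : MeasurableSet U) {c C : ℝ} (hc : 0 < c)
    (hUc : ∀ a ∈ U, c ≤ a ∧ a ≤ C) {A E : Set B} (hA : MeasurableSet A) (hE : MeasurableSet E)
    (hlac : IsLacunary α U E) {e : ℕ → Γ}
    (hexh : η (A \ ((⋃ n, greedyStep α U A e n) ∪
      ⋃ n, {b | (e n)⁻¹ • b ∈ greedyStep α U A e n})) = 0) :
    η A ≤ (1 + ENNReal.ofReal C) * ((1 + (ENNReal.ofReal c)⁻¹) * η (A \ E)) := by
  set D := greedyStep α U A e with hDdef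
  set R : ℕ → Set B := fun n => {b | (e n)⁻¹ • b ∈ D n} with hRdef
  have hDm : ∀ n, MeasurableSet (D n) := fun n => (measurableSet_greedyMatching hα hU hA n).2.2
  have hRm : ∀ n, MeasurableSet (R n) := fun n => measurable_const_smul (e n)⁻¹ (hDm n)
  have hc0 : ENNReal.ofReal c ≠ 0 := (ENNReal.ofReal_pos.mpr hc).ne'
  have hAE : MeasurableSet (A \ E) := hA.diff hE
  -- the points of the domain sent outside of `E`
  have hout : ∀ n, η (D n ∩ {b | e n • b ∈ A \ E}) ≤
      (ENNReal.ofReal c)⁻¹ * η ((A \ E) ∩ R n) := by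
    intro n
    have hm : MeasurableSet (D n ∩ {b | e n • b ∈ A \ E}) :=
      (hDm n).inter (measurable_const_smul (e n) hAE)
    have h := mul_measure_le_measure_smul hq hη (e n) hm (hα _) (c := c)
      (fun b hb => (hUc _ hb.1.2.2.1).1)
    rw [← ENNReal.mul_le_iff_le_inv hc0 ENNReal.ofReal_ne_top]
    refine h.trans (measure_mono ?_)
    rintro b ⟨hb1, hb2⟩
    rw [mem_ofPred_eq, smul_inv_smul] at hb2
    exact ⟨hb2, hb1⟩
  -- A domain point lies in `A \ E`, or is sent there because `E` is lacunary. The second kind is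
  -- charged to its images, which are disjoint for different steps; this costs the factor `c⁻¹`.
  have hdom : η (⋃ n, D n) ≤ (1 + (ENNReal.ofReal c)⁻¹) * η (A \ E) := by
    have hsub : (⋃ n, D n) ⊆ (A \ E) ∪ ⋃ n, D n ∩ {b | e n • b ∈ A \ E} := by
      intro b hb
      obtain ⟨n, hn⟩ := mem_iUnion.mp hb
      by_cases hbE : b ∈ E
      · refine Or.inr (mem_iUnion.mpr ⟨n, hn, hn.2.1.1, fun hgE => ?_⟩)
        exact hlac b hbE _ hn.2.2.2 hgE hn.2.2.1
      · exact Or.inl ⟨hn.1.1, hbE⟩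
    calc η (⋃ n, D n) ≤ η (A \ E) + ∑' n, η (D n ∩ {b | e n • b ∈ A \ E}) :=
          (measure_mono hsub).trans ((measure_union_le _ _).trans
            (add_le_add le_rfl (measure_iUnion_le _)))
      _ ≤ η (A \ E) + ∑' n, (ENNReal.ofReal c)⁻¹ * η ((A \ E) ∩ R n) :=
          add_le_add le_rfl (ENNReal.tsum_le_tsum hout)
      _ = η (A \ E) + (ENNReal.ofReal c)⁻¹ * η (⋃ n, (A \ E) ∩ R n) := by
          rw [ENNReal.tsum_mul_left, measure_iUnion _ fun n => hAE.inter (hRm n)]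
          intro m n hmn
          exact (disjoint_range_greedyStep hmn).mono inter_subset_right inter_subset_right
      _ ≤ η (A \ E) + (ENNReal.ofReal c)⁻¹ * η (A \ E) := by
          gcongr
          exact iUnion_subset fun n => inter_subset_left
      _ = _ := by rw [add_mul, one_mul]
  -- This is where an upper bound on `U` is indispensable.
  have hran : η (⋃ n, R n) ≤ ENNReal.ofReal C * η (⋃ n, D n) := by
    calc η (⋃ n, R n) ≤ ∑' n, η (R n) := measure_iUnion_le _
      _ ≤ ∑' n, ENNReal.ofReal C * η (D n) := ENNReal.tsum_le_tsum fun n =>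
          measure_smul_le hq hη (e n) (hDm n) fun b hb => (hUc _ hb.2.2.1).2
      _ = _ := by rw [ENNReal.tsum_mul_left, measure_iUnion disjoint_greedyStep hDm]
  calc η A ≤ η ((A \ ((⋃ n, D n) ∪ ⋃ n, R n)) ∪ ((⋃ n, D n) ∪ ⋃ n, R n)) :=
        measure_mono (by rw [sdiff_union_self]; exact subset_union_left)
    _ ≤ 0 + (η (⋃ n, D n) + η (⋃ n, R n)) :=
        (measure_union_le _ _).trans (add_le_add hexh.le (measure_union_le _ _))
    _ ≤ (1 + ENNReal.ofReal C) * η (⋃ n, D n) := by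
        rw [zero_add, add_mul, one_mul]; gcongr
    _ ≤ _ := by gcongr

/-- Recurrence with cocycle values in a set bounded away from `0` and `∞` can be tested on a
countable algebra generating the `σ`-algebra. -/
theorem isRecurrent_of_exhausted (hα : ∀ g, Measurable (α g)) (hq : IsQuasiInvariant Γ η)
    (hη : AgreesWithRN η α) {U : Set ℝ} (hU : MeasurableSet U) {c C : ℝ} (hc : 0 < c)
    (hUc : ∀ a ∈ U, c ≤ a ∧ a ≤ C) {𝒜 : Set (Set B)} (h𝒜 : η.MeasureDense 𝒜) {e : ℕ → Γ}
    (hexh : ∀ A ∈ 𝒜, η (A \ ((⋃ n, greedyStep α U A e n) ∪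
      ⋃ n, {b | (e n)⁻¹ • b ∈ greedyStep α U A e n})) = 0) : IsRecurrent η α U := by
  intro E hE hlac
  set K : ℝ≥0∞ := (1 + ENNReal.ofReal C) * (1 + (ENNReal.ofReal c)⁻¹) with hK
  have hKtop : K ≠ ∞ := ENNReal.mul_ne_top (by finiteness)
    (ENNReal.add_ne_top.mpr ⟨by finiteness,
      ENNReal.inv_ne_top.mpr (ENNReal.ofReal_pos.mpr hc).ne'⟩)
  have hbound : ∀ ε : ℝ, 0 < ε → η E ≤ (1 + K) * ENNReal.ofReal ε := by
    intro ε hε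
    obtain ⟨A, hA𝒜, hA⟩ := h𝒜.approx E hE (measure_ne_top _ _) ε hε
    have h := measure_le_of_isLacunary hα hq hη hU hc hUc (h𝒜.measurable A hA𝒜) hE hlac
      (hexh A hA𝒜)
    have h1 : η (E \ A) ≤ ENNReal.ofReal ε := (measure_mono le_sup_left).trans hA.le
    have h2 : η (A \ E) ≤ ENNReal.ofReal ε := (measure_mono le_sup_right).trans hA.le
    calc η E ≤ η (E \ A ∪ A) := measure_mono (by rw [sdiff_union_self]; exact subset_union_left)
      _ ≤ η (E \ A) + η A := measure_union_le _ _
      _ ≤ ENNReal.ofReal ε + K * ENNReal.ofReal ε := by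
          refine add_le_add h1 (h.trans ?_)
          rw [← mul_assoc]
          gcongr
      _ = _ := by rw [add_mul, one_mul]
  have hlim : Tendsto (fun ε : ℝ => (1 + K) * ENNReal.ofReal ε) (𝓝[>] 0) (𝓝 0) := by
    have h0 : Tendsto ENNReal.ofReal (𝓝[>] (0 : ℝ)) (𝓝 0) := by
      simpa using (ENNReal.continuous_ofReal.tendsto 0).mono_left nhdsWithin_le_nhds
    simpa using ENNReal.Tendsto.const_mul h0 (Or.inr (by finiteness))
  exact le_antisymm (ge_of_tendsto hlim (eventually_mem_nhdsWithin.mono hbound)) zero_le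

end Approximation

/-! ### Recurrence of a mixture and of its components -/

section Decomposition

variable {Γ B : Type*} [Group Γ] [Countable Γ] [mB : MeasurableSpace B] [MulAction Γ B]
  [MeasurableConstSMul Γ B] {α : Γ → B → ℝ}

omit [Countable Γ] [MeasurableConstSMul Γ B] in
theorem isRecurrent_join_of_ae {ω : Measure (Measure B)} {U : Set ℝ}
    (h : ∀ᵐ η ∂ω, IsRecurrent η α U) : IsRecurrent ω.join α U := by
  intro A hA hl
  rw [Measure.join_apply hA, lintegral_eq_zero_iff (Measure.measurable_coe hA)]
  exact h.mono fun η hη => hη A hA hl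

/-- Only countably many leftovers of greedy matchings need to be null, so a single exceptional null
set of components suffices. -/
theorem ae_isRecurrent_of_join [MeasurableSpace.CountablyGenerated B] (hα : ∀ g, Measurable (α g))
    {ω : Measure (Measure B)}
    (hω : ∀ᵐ η ∂ω, IsProbabilityMeasure η ∧ IsQuasiInvariant Γ η ∧ AgreesWithRN η α)
    {U : Set ℝ} (hU : MeasurableSet U) {c C : ℝ} (hc : 0 < c) (hUc : ∀ a ∈ U, c ≤ a ∧ a ≤ C)
    (h : IsRecurrent ω.join α U) : ∀ᵐ η ∂ω, IsRecurrent η α U := by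
  obtain ⟨e, he⟩ := exists_surjective_nat Γ
  let 𝒜 := generateSetAlgebra (MeasurableSpace.countableGeneratingSet B)
  have h𝒜c : 𝒜.Countable :=
    countable_generateSetAlgebra (MeasurableSpace.countable_countableGeneratingSet)
  have h𝒜g : mB = MeasurableSpace.generateFrom 𝒜 := by
    rw [generateFrom_generateSetAlgebra_eq, MeasurableSpace.generateFrom_countableGeneratingSet]
  have hexh : ∀ᵐ η ∂ω, ∀ A ∈ 𝒜, η (A \ ((⋃ n, greedyStep α U A e n) ∪
      ⋃ n, {b | (e n)⁻¹ • b ∈ greedyStep α U A e n})) = 0 := by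
    rw [ae_ball_iff h𝒜c]
    intro A hA𝒜
    have hA : MeasurableSet A := by
      rw [h𝒜g]
      exact MeasurableSpace.measurableSet_generateFrom hA𝒜
    have hm := fun n => (measurableSet_greedyMatching (e := e) hα hU hA n).2.2
    have hmeas : MeasurableSet (A \ ((⋃ n, greedyStep α U A e n) ∪
        ⋃ n, {b | (e n)⁻¹ • b ∈ greedyStep α U A e n})) :=
      hA.diff ((MeasurableSet.iUnion hm).union
        (MeasurableSet.iUnion fun n => measurable_const_smul (e n)⁻¹ (hm n)))
    have h0 := h _ hmeas (isLacunary_sdiff_greedyStep he)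
    rwa [Measure.join_apply hmeas, lintegral_eq_zero_iff (Measure.measurable_coe hmeas)] at h0
  filter_upwards [hexh, hω] with η hη ⟨hprob, hq, hag⟩
  exact isRecurrent_of_exhausted hα hq hag hU hc hUc
    (Measure.MeasureDense.of_generateFrom_isSetAlgebra_finite η isSetAlgebra_generateSetAlgebra h𝒜g)
    hη

end Decomposition

/-! ### Projection onto invariant functions, simultaneously for all components -/

section Projection

variable {ι X : Type*} [MeasurableSpace X] (T : ι → X ≃ᵐ X) (β : ι → X → ℝ)

/-- The functions `β i` are the Radon-Nikodym derivatives of `σ ∘ T i` with respect to `σ`. -/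
def IsCocycleMeasure (σ : Measure X) : Prop :=
  ∀ i, (σ.withDensity fun x => ENNReal.ofReal (β i x)).map (T i) = σ

/-- Bounded measurable functions invariant under all `T i`. -/
structure IsBoundedInvariant (k : X → ℝ) : Prop where
  measurable : Measurable k
  bounded : ∃ C, ∀ x, |k x| ≤ C
  invariant : ∀ i x, k (T i x) = k x

/-- Bounded measurable functions which are orthogonal to the invariant ones for every finite
measure with Radon-Nikodym cocycle `β`. -/
structure IsUniversallyNull (F : X → ℝ) : Prop where
  measurable : Measurable F
  bounded : ∃ C, ∀ x, |F x| ≤ C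
  integral_mul : ∀ σ : Measure X, IsFiniteMeasure σ → IsCocycleMeasure T β σ →
    ∀ k, IsBoundedInvariant T k → ∫ x, F x * k x ∂σ = 0

variable {T β}

theorem integrable_of_bounded {σ : Measure X} [IsFiniteMeasure σ] {F : X → ℝ} (hF : Measurable F)
    (hb : ∃ C, ∀ x, |F x| ≤ C) : Integrable F σ := by
  obtain ⟨C, hC⟩ := hb
  exact Integrable.of_bound hF.aestronglyMeasurable C (ae_of_all _ hC)

theorem IsBoundedInvariant.bounded_mul {k F : X → ℝ} (hk : IsBoundedInvariant T k)
    (hb : ∃ C, ∀ x, |F x| ≤ C) : ∃ C, ∀ x, |F x * k x| ≤ C := by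
  obtain ⟨C, hC⟩ := hb
  obtain ⟨C', hC'⟩ := hk.bounded
  refine ⟨C * C', fun x => ?_⟩
  rw [abs_mul]
  exact mul_le_mul (hC x) (hC' x) (abs_nonneg _) ((abs_nonneg _).trans (hC x))

theorem isUniversallyNull_zero : IsUniversallyNull T β (0 : X → ℝ) :=
  ⟨measurable_zero, ⟨0, by simp⟩, by simp⟩

theorem IsUniversallyNull.add {F G : X → ℝ} (hF : IsUniversallyNull T β F)
    (hG : IsUniversallyNull T β G) : IsUniversallyNull T β (F + G) where
  measurable := hF.measurable.add hG.measurable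
  bounded := by
    obtain ⟨C, hC⟩ := hF.bounded
    obtain ⟨C', hC'⟩ := hG.bounded
    exact ⟨C + C', fun x => (abs_add_le _ _).trans (add_le_add (hC x) (hC' x))⟩
  integral_mul σ _ hσ k hk := by
    have h1 : Integrable (fun x => F x * k x) σ :=
      integrable_of_bounded (hF.measurable.mul hk.measurable) (hk.bounded_mul hF.bounded)
    have h2 : Integrable (fun x => G x * k x) σ :=
      integrable_of_bounded (hG.measurable.mul hk.measurable) (hk.bounded_mul hG.bounded)
    simp only [Pi.add_apply, add_mul]
    rw [integral_add h1 h2, hF.integral_mul σ inferInstance hσ k hk,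
      hG.integral_mul σ inferInstance hσ k hk, add_zero]

theorem IsUniversallyNull.const_smul {F : X → ℝ} (hF : IsUniversallyNull T β F) (c : ℝ) :
    IsUniversallyNull T β (c • F) where
  measurable := hF.measurable.const_smul c
  bounded := by
    obtain ⟨C, hC⟩ := hF.bounded
    refine ⟨|c| * C, fun x => ?_⟩
    rw [Pi.smul_apply, smul_eq_mul, abs_mul]
    exact mul_le_mul_of_nonneg_left (hC x) (abs_nonneg c)
  integral_mul σ hfin hσ k hk := by
    simp only [Pi.smul_apply, smul_eq_mul, mul_assoc]
    rw [integral_const_mul, hF.integral_mul σ hfin hσ k hk, mul_zero]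

theorem IsCocycleMeasure.integral_eq {σ : Measure X} (hσ : IsCocycleMeasure T β σ)
    (hβ : ∀ i, Measurable (β i)) (hpos : ∀ i x, 0 < β i x) (i : ι) (G : X → ℝ) :
    ∫ x, G x ∂σ = ∫ x, β i x * G (T i x) ∂σ := by
  conv_lhs => rw [← hσ i]
  rw [integral_map_equiv]
  have h := integral_withDensity_eq_integral_smul (μ := σ) (hβ i).real_toNNReal
    (fun x => G (T i x))
  refine h.trans (integral_congr_ae (ae_of_all _ fun x => ?_))
  simp only [NNReal.smul_def, smul_eq_mul, Real.coe_toNNReal _ (hpos i x).le]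

theorem IsCocycleMeasure.integrable {σ : Measure X} (hσ : IsCocycleMeasure T β σ)
    (hβ : ∀ i, Measurable (β i)) (hpos : ∀ i x, 0 < β i x) (i : ι) {G : X → ℝ}
    (hG : Integrable G σ) : Integrable (fun x => β i x * G (T i x)) σ := by
  rw [← hσ i, integrable_map_equiv] at hG
  have h := (integrable_withDensity_iff_integrable_smul (μ := σ) (hβ i).real_toNNReal).mp hG
  refine h.congr (ae_of_all _ fun x => ?_)
  simp only [NNReal.smul_def, smul_eq_mul, Real.coe_toNNReal _ (hpos i x).le, Function.comp_apply]

/-- The coboundary of the indicator function of a set on which the cocycle is bounded. -/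
theorem isUniversallyNull_coboundary (hβ : ∀ i, Measurable (β i)) (hpos : ∀ i x, 0 < β i x)
    (i : ι) {D : Set X} (hD : MeasurableSet D) {C : ℝ} (hC : ∀ x ∈ D, β i x ≤ C) :
    IsUniversallyNull T β (fun x => D.indicator (β i) x - ((T i).symm ⁻¹' D).indicator 1 x) where
  measurable := ((hβ i).indicator hD).sub
    (measurable_one.indicator ((T i).symm.measurable hD))
  bounded := by
    refine ⟨|C| + 1, fun x => (abs_sub _ _).trans (add_le_add ?_ ?_)⟩
    · by_cases hx : x ∈ D
      · rw [indicator_of_mem hx, abs_of_pos (hpos i x)]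
        exact (hC x hx).trans (le_abs_self C)
      · rw [indicator_of_notMem hx, abs_zero]
        exact abs_nonneg C
    · by_cases hx : x ∈ (T i).symm ⁻¹' D
      · rw [indicator_of_mem hx, Pi.one_apply, abs_one]
      · rw [indicator_of_notMem hx, abs_zero]
        exact zero_le_one
  integral_mul σ _ hσ k hk := by
    have h1 : Integrable (fun x => ((T i).symm ⁻¹' D).indicator 1 x * k x) σ := by
      refine integrable_of_bounded ((measurable_one.indicator
        ((T i).symm.measurable hD)).mul hk.measurable) (hk.bounded_mul ⟨1, fun x => ?_⟩)
      by_cases hx : x ∈ (T i).symm ⁻¹' D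
      · rw [indicator_of_mem hx, Pi.one_apply, abs_one]
      · rw [indicator_of_notMem hx, abs_zero]
        exact zero_le_one
    -- Transporting the second term along `T i` turns it into the first, because `k` is invariant.
    have heq : ∀ x, β i x * (((T i).symm ⁻¹' D).indicator 1 (T i x) * k (T i x)) =
        D.indicator (β i) x * k x := by
      intro x
      rw [hk.invariant]
      by_cases hx : x ∈ D <;> simp [indicator, hx]
    have h2 : Integrable (fun x => D.indicator (β i) x * k x) σ :=
      (hσ.integrable hβ hpos i h1).congr (ae_of_all _ heq)
    simp only [sub_mul]
    rw [integral_sub h2 h1,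
      hσ.integral_eq hβ hpos i (fun x => ((T i).symm ⁻¹' D).indicator 1 x * k x), sub_eq_zero]
    exact integral_congr_ae (ae_of_all _ fun x => (heq x).symm)

variable (T β) in
/-- The classes in `L²` of the universally null functions. -/
def nullSubmodule (μ : Measure X) : Submodule ℝ (Lp ℝ 2 μ) where
  carrier := {s | ∃ F, IsUniversallyNull T β F ∧ s =ᵐ[μ] F}
  add_mem' := by
    rintro s t ⟨F, hF, hsF⟩ ⟨G, hG, htG⟩
    exact ⟨F + G, hF.add hG, (Lp.coeFn_add s t).trans (hsF.add htG)⟩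
  zero_mem' := ⟨0, isUniversallyNull_zero, Lp.coeFn_zero ℝ 2 μ⟩
  smul_mem' := by
    rintro c s ⟨F, hF, hsF⟩
    exact ⟨c • F, hF.const_smul c, (Lp.coeFn_smul c s).trans (hsF.const_smul c)⟩

/-- Elements of `L²` orthogonal to the universally null functions are invariant. -/
theorem ae_invariant_of_mem_orthogonal {μ : Measure X} [IsFiniteMeasure μ]
    (hμ : IsCocycleMeasure T β μ) (hβ : ∀ i, Measurable (β i)) (hpos : ∀ i x, 0 < β i x)
    {s : Lp ℝ 2 μ} (hs : s ∈ (nullSubmodule T β μ)ᗮ) (i : ι) :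
    ∀ᵐ x ∂μ, s (T i x) = s x := by
  have hint : Integrable s μ := (Lp.memLp s).integrable one_le_two
  have hintT : Integrable (fun x => β i x * s (T i x)) μ := hμ.integrable hβ hpos i hint
  -- Truncating at `β i ≤ n` keeps the coboundaries bounded. Orthogonality to them says that `β i *
  -- (s - s ∘ T i)` has integral zero over every measurable set in the truncation.
  have key : ∀ n : ℕ, ∀ᵐ x ∂μ.restrict {x | β i x ≤ n}, β i x * s x - β i x * s (T i x) = 0 := by
    intro n
    have hV : MeasurableSet {x | β i x ≤ n} := measurableSet_le (hβ i) measurable_const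
    have hintβ : Integrable (fun x => β i x * s x) (μ.restrict {x | β i x ≤ n}) := by
      refine hint.restrict.bdd_mul (c := n) (hβ i).aestronglyMeasurable ?_
      filter_upwards [ae_restrict_mem hV] with x hx
      rw [Real.norm_of_nonneg (hpos i x).le]
      exact hx
    refine Integrable.ae_eq_zero_of_forall_setIntegral_eq_zero (hintβ.sub hintT.restrict) ?_
    intro D hD _
    set E := D ∩ {x | β i x ≤ n} with hE
    have hEm : MeasurableSet E := hD.inter hV
    have hF := isUniversallyNull_coboundary (T := T) hβ hpos i hEm (C := n) fun x hx => hx.2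
    set F : X → ℝ := fun x => E.indicator (β i) x - ((T i).symm ⁻¹' E).indicator 1 x with hFdef
    have hFLp : MemLp F 2 μ := by
      obtain ⟨C, hC⟩ := hF.bounded
      exact MemLp.of_bound hF.measurable.aestronglyMeasurable C (ae_of_all _ hC)
    have horth : inner ℝ (hFLp.toLp F) s = 0 :=
      (Submodule.mem_orthogonal _ s).mp hs _ ⟨F, hF, hFLp.coeFn_toLp⟩
    have hzero : ∫ x, s x * F x ∂μ = 0 := by
      rw [← horth, L2.inner_def]
      refine integral_congr_ae (hFLp.coeFn_toLp.mono fun x hx => ?_)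
      simp only [hx]
      rfl
    have hint1 : Integrable (fun x => s x * E.indicator (β i) x) μ := by
      have h : IntegrableOn (fun x => β i x * s x) E μ :=
        hintβ.mono_measure (Measure.restrict_mono inter_subset_right le_rfl)
      refine ((integrable_indicator_iff hEm).mpr h).congr (ae_of_all _ fun x => ?_)
      by_cases hx : x ∈ E <;> simp [hx, mul_comm]
    have hint2 : Integrable (fun x => s x * ((T i).symm ⁻¹' E).indicator 1 x) μ := by
      refine (hint.indicator ((T i).symm.measurable hEm)).congr (ae_of_all _ fun x => ?_)
      by_cases hx : x ∈ (T i).symm ⁻¹' E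
      · simp only [indicator_of_mem hx, Pi.one_apply, mul_one]
      · simp only [indicator_of_notMem hx, mul_zero]
    have hEint : ∫ x in E, (β i x * s x - β i x * s (T i x)) ∂μ = 0 := by
      rw [integral_sub (hintβ.mono_measure (Measure.restrict_mono inter_subset_right le_rfl))
        hintT.integrableOn, ← integral_indicator hEm, ← integral_indicator hEm]
      rw [← hzero]
      simp only [hFdef, mul_sub]
      rw [integral_sub hint1 hint2,
        hμ.integral_eq hβ hpos i (fun x => s x * ((T i).symm ⁻¹' E).indicator 1 x)]
      congr 1 <;> refine integral_congr_ae (ae_of_all _ fun x => ?_) <;>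
        by_cases hx : x ∈ E <;> simp [indicator, hx, mul_comm]
    rwa [Measure.restrict_restrict hD]
  have hall : ∀ᵐ x ∂μ, ∀ n : ℕ, β i x ≤ n → β i x * s x - β i x * s (T i x) = 0 := by
    rw [ae_all_iff]
    exact fun n => (ae_restrict_iff' (measurableSet_le (hβ i) measurable_const)).mp (key n)
  filter_upwards [hall] with x hx
  obtain ⟨n, hn⟩ := exists_nat_ge (β i x)
  have h := hx n hn
  rw [← mul_sub, mul_eq_zero] at h
  exact (sub_eq_zero.mp (h.resolve_left (hpos i x).ne')).symm

/-- The conditional expectation onto the invariant functions, formed with respect to a mixture of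
measures with the same Radon-Nikodym cocycle, is also the conditional expectation with respect to
almost every component. -/
theorem exists_ae_invariant_projection [Countable ι] {Ω : Type*} [MeasurableSpace Ω]
    {ω : Measure Ω} {K : Ω → Measure X} (hK : Measurable K) [IsProbabilityMeasure (ω.bind K)]
    (hβ : ∀ i, Measurable (β i)) (hpos : ∀ i x, 0 < β i x)
    (hM : IsCocycleMeasure T β (ω.bind K))
    (hMae : ∀ᵐ t ∂ω, IsProbabilityMeasure (K t) ∧ IsCocycleMeasure T β (K t))
    {ξ : X → ℝ} (hξ : Measurable ξ) (hξb : ∃ C, ∀ x, |ξ x| ≤ C) :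
    ∃ u : X → ℝ, Measurable u ∧ ∀ᵐ t ∂ω, Integrable u (K t) ∧ (∀ i, ∀ᵐ x ∂(K t), u (T i x) = u x) ∧
      ∀ k, IsBoundedInvariant T k → ∫ x, (ξ x - u x) * k x ∂(K t) = 0 := by
  set μ := ω.bind K with hμ
  have hξLp : MemLp ξ 2 μ := by
    obtain ⟨C, hC⟩ := hξb
    exact MemLp.of_bound hξ.aestronglyMeasurable C (ae_of_all _ hC)
  set S := (nullSubmodule T β μ).topologicalClosure with hS
  have hScomplete : CompleteSpace S :=
    (Submodule.isClosed_topologicalClosure _).completeSpace_coe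
  -- The invariant part is `v`; the remainder `w` is a limit of functions null for every measure
  -- with cocycle `β`, in particular for almost every component.
  obtain ⟨w, hw, v, hv, hwv⟩ := S.exists_add_mem_mem_orthogonal (hξLp.toLp ξ)
  have hv' : v ∈ (nullSubmodule T β μ)ᗮ :=
    Submodule.orthogonal_le (Submodule.le_topologicalClosure _) hv
  have hvm : Measurable v := (Lp.stronglyMeasurable v).measurable
  have hvint : Integrable v μ := (Lp.memLp v).integrable one_le_two
  -- universally null approximations of `ξ - v`
  have happrox : ∀ n : ℕ, ∃ F, IsUniversallyNull T β F ∧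
      ∫⁻ x, ‖ξ x - v x - F x‖ₑ ∂μ ≤ (2⁻¹ : ℝ≥0∞) ^ n := by
    intro n
    have hwcl : w ∈ closure (nullSubmodule T β μ : Set (Lp ℝ 2 μ)) := hw
    obtain ⟨s, ⟨F, hF, hsF⟩, hs⟩ := EMetric.mem_closure_iff.mp hwcl ((2⁻¹ : ℝ≥0∞) ^ n)
      (ENNReal.pow_pos (by simp) n)
    refine ⟨F, hF, le_trans ?_ hs.le⟩
    have hwe : w = hξLp.toLp ξ - v := by rw [hwv]; abel
    rw [Lp.edist_def, ← eLpNorm_one_eq_lintegral_enorm]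
    have hae : (fun x => ξ x - v x - F x) =ᵐ[μ] (w : X → ℝ) - s := by
      rw [hwe]
      filter_upwards [Lp.coeFn_sub (hξLp.toLp ξ) v, hξLp.coeFn_toLp, hsF] with x h1 h2 h3
      simp only [Pi.sub_apply, h1, h2, h3]
    rw [eLpNorm_congr_ae hae]
    exact eLpNorm_le_eLpNorm_of_exponent_le one_le_two
      ((Lp.aestronglyMeasurable w).sub (Lp.aestronglyMeasurable s))
  choose F hF hFapprox using happrox
  have hFm : ∀ n, Measurable fun x => ‖ξ x - v x - F n x‖ₑ := fun n =>
    ((hξ.sub hvm).sub (hF n).measurable).enorm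
  have hKm : ∀ {f : X → ℝ≥0∞}, Measurable f → Measurable fun t => ∫⁻ x, f x ∂(K t) := fun hf =>
    (Measure.measurable_lintegral hf).comp hK
  -- Summable errors give `L¹` convergence on almost every component without passing to
  -- subsequences. The exceptional set does not depend on `k`, so `k` may later depend on the
  -- component.
  have hsum : ∫⁻ t, ∑' n, ∫⁻ x, ‖ξ x - v x - F n x‖ₑ ∂(K t) ∂ω ≠ ∞ := by
    rw [lintegral_tsum fun n => (hKm (hFm n)).aemeasurable]
    refine ne_top_of_le_ne_top (b := ∑' n : ℕ, (2⁻¹ : ℝ≥0∞) ^ n) ?_ (ENNReal.tsum_le_tsum ?_)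
    · rw [ENNReal.tsum_geometric]
      simp
    · intro n
      rw [← Measure.lintegral_bind hK.aemeasurable (hFm n).aemeasurable]
      exact hFapprox n
  have hsumae : ∀ᵐ t ∂ω, ∑' n, ∫⁻ x, ‖ξ x - v x - F n x‖ₑ ∂(K t) < ∞ :=
    ae_lt_top (Measurable.tsum fun n => hKm (hFm n)) hsum
  have hinv : ∀ᵐ t ∂ω, ∀ᵐ x ∂(K t), ∀ i, v (T i x) = v x :=
    Measure.ae_ae_of_ae_bind hK.aemeasurable
      (ae_all_iff.mpr fun i => ae_invariant_of_mem_orthogonal hM hβ hpos hv' i)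
  have hintae : ∀ᵐ t ∂ω, ∫⁻ x, ‖v x‖ₑ ∂(K t) < ∞ := by
    refine ae_lt_top (hKm hvm.enorm) ?_
    rw [← Measure.lintegral_bind hK.aemeasurable hvm.enorm.aemeasurable]
    exact hvint.2.ne
  refine ⟨v, hvm, ?_⟩
  filter_upwards [hMae, hsumae, hinv, hintae] with t ⟨hprob, hσ⟩ hσsum hσinv hσint
  set σ := K t
  have hvσ : Integrable v σ := ⟨hvm.aestronglyMeasurable, hσint⟩
  refine ⟨hvσ, fun i => hσinv.mono fun x hx => hx i, fun k hk => ?_⟩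
  obtain ⟨C, hC⟩ := hk.bounded
  have hlim : Tendsto (fun n => C * (∫⁻ x, ‖ξ x - v x - F n x‖ₑ ∂σ).toReal) atTop (𝓝 0) := by
    have h := ENNReal.tendsto_atTop_zero_of_tsum_ne_top hσsum.ne
    have h' := (ENNReal.tendsto_toReal ENNReal.zero_ne_top).comp h
    simpa using h'.const_mul C
  have hbound : ∀ n, |∫ x, (ξ x - v x) * k x ∂σ| ≤
      C * (∫⁻ x, ‖ξ x - v x - F n x‖ₑ ∂σ).toReal := by
    intro n
    have hi : Integrable (fun x => ξ x - v x) σ := (integrable_of_bounded hξ hξb).sub hvσ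
    have hiF : Integrable (F n) σ := integrable_of_bounded (hF n).measurable (hF n).bounded
    have hkb : ∀ᵐ x ∂σ, ‖k x‖ ≤ C := ae_of_all _ hC
    have h1 : ∫ x, (ξ x - v x) * k x ∂σ = ∫ x, (ξ x - v x - F n x) * k x ∂σ := by
      simp only [sub_mul _ (F n _)]
      rw [integral_sub (hi.mul_bdd hk.measurable.aestronglyMeasurable hkb)
        (hiF.mul_bdd hk.measurable.aestronglyMeasurable hkb),
        (hF n).integral_mul σ inferInstance hσ k hk, sub_zero]
    have h2 : Integrable (fun x => ξ x - v x - F n x) σ := hi.sub hiF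
    rw [h1, ← integral_norm_eq_lintegral_enorm h2.aestronglyMeasurable, ← integral_const_mul]
    refine (abs_integral_le_integral_abs).trans (integral_mono_of_nonneg
      (ae_of_all _ fun x => abs_nonneg _) (h2.norm.const_mul C)
      (ae_of_all _ fun x => ?_))
    simp only [abs_mul]
    rw [mul_comm]
    exact mul_le_mul_of_nonneg_right (hC x) (abs_nonneg _)
  exact abs_nonpos_iff.mp (ge_of_tendsto' hlim hbound)

end Projection

/-! ### The skew product action on `B × ℝ` -/

section SkewProduct

variable {Γ B : Type*} [Group Γ] [MulAction Γ B] [MeasurableSpace B] [MeasurableConstSMul Γ B]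

/-- The skew product action `g (b, x) = (g b, x - log α(g, b))` on `B × ℝ`. -/
noncomputable def skewEquiv {α : Γ → B → ℝ} (hα : ∀ g, Measurable (α g)) (hpos : ∀ g b, 0 < α g b)
    (hcoc : ∀ g₁ g₂ b, α g₂ (g₁ • b) * α g₁ b = α (g₂ * g₁) b) (g : Γ) : B × ℝ ≃ᵐ B × ℝ where
  toFun z := (g • z.1, z.2 - Real.log (α g z.1))
  invFun z := (g⁻¹ • z.1, z.2 - Real.log (α g⁻¹ z.1))
  left_inv z := by
    simp only [inv_smul_smul, cocycle_inv hpos hcoc, Real.log_inv]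
    ext <;> simp
  right_inv z := by
    have h := cocycle_inv hpos hcoc g⁻¹ z.1
    rw [inv_inv] at h
    simp only [smul_inv_smul, h, Real.log_inv]
    ext <;> simp
  measurable_toFun := (measurable_fst.const_smul g).prodMk
    (measurable_snd.sub (Real.measurable_log.comp ((hα g).comp measurable_fst)))
  measurable_invFun := (measurable_fst.const_smul g⁻¹).prodMk
    (measurable_snd.sub (Real.measurable_log.comp ((hα g⁻¹).comp measurable_fst)))

/-- The Radon-Nikodym cocycle of the skew product action for `η × p(x) dx`. -/
noncomputable def skewCocycle (α : Γ → B → ℝ) (p : ℝ → ℝ) (g : Γ) (z : B × ℝ) : ℝ :=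
  α g z.1 * p (z.2 - Real.log (α g z.1)) / p z.2

variable {α : Γ → B → ℝ} (hα : ∀ g, Measurable (α g)) (hpos : ∀ g b, 0 < α g b)
  (hcoc : ∀ g₁ g₂ b, α g₂ (g₁ • b) * α g₁ b = α (g₂ * g₁) b) {p : ℝ → ℝ} (hp : Measurable p)
  (hp0 : ∀ x, 0 < p x)

omit [Group Γ] [MulAction Γ B] [MeasurableConstSMul Γ B] in
include hα hp in
theorem measurable_skewCocycle (g : Γ) : Measurable (skewCocycle α p g) :=
  (((hα g).comp measurable_fst).mul (hp.comp (measurable_snd.sub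
    (Real.measurable_log.comp ((hα g).comp measurable_fst))))).div (hp.comp measurable_snd)

omit [MulAction Γ B] [MeasurableSpace B] [MeasurableConstSMul Γ B] [Group Γ] in
include hpos hp0 in
theorem skewCocycle_pos (g : Γ) (z : B × ℝ) : 0 < skewCocycle α p g z :=
  div_pos (mul_pos (hpos _ _) (hp0 _)) (hp0 _)

include hp hp0 in
theorem isCocycleMeasure_prod {η : Measure B} [IsFiniteMeasure η] (hq : IsQuasiInvariant Γ η)
    (hη : AgreesWithRN η α) :
    IsCocycleMeasure (skewEquiv hα hpos hcoc) (skewCocycle α p)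
      (η.prod (volume.withDensity fun x => ENNReal.ofReal (p x))) := by
  intro g
  set ρ : Measure ℝ := volume.withDensity fun x => ENNReal.ofReal (p x) with hρ
  have hpm : Measurable fun x => ENNReal.ofReal (p x) := hp.ennreal_ofReal
  have hβm : Measurable fun z => ENNReal.ofReal (skewCocycle α p g z) :=
    (measurable_skewCocycle hα hp g).ennreal_ofReal
  refine Measure.ext_of_lintegral _ fun F hF => ?_
  have hFT : Measurable fun z => F (skewEquiv hα hpos hcoc g z) :=
    hF.comp (skewEquiv hα hpos hcoc g).measurable
  rw [lintegral_map hF (skewEquiv hα hpos hcoc g).measurable,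
    lintegral_withDensity_eq_lintegral_mul _ hβm hFT, lintegral_prod _ (hβm.mul hFT).aemeasurable,
    lintegral_prod _ hF.aemeasurable]
  rw [← lintegral_cocycle_mul_smul hq hη g hF.lintegral_prod_right']
  refine lintegral_congr fun b => ?_
  have hFb : Measurable fun x : ℝ => F (g • b, x) := hF.comp measurable_prodMk_left
  have h2 : Measurable fun x : ℝ =>
      ENNReal.ofReal (skewCocycle α p g (b, x)) * F (skewEquiv hα hpos hcoc g (b, x)) :=
    (hβm.mul hFT).comp measurable_prodMk_left
  simp only [Pi.mul_apply]
  rw [hρ, lintegral_withDensity_eq_lintegral_mul _ hpm h2,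
    lintegral_withDensity_eq_lintegral_mul _ hpm hFb,
    ← lintegral_const_mul _ (hpm.mul hFb)]
  simp only [Pi.mul_apply]
  -- Substituting `x - log α(g, b)` for `x` leaves Lebesgue measure unchanged; the density changes
  -- by the `p` quotient in `skewCocycle`.
  rw [← lintegral_sub_right_eq_self 
    (fun x => ENNReal.ofReal (α g b) * (ENNReal.ofReal (p x) * F (g • b, x))) (Real.log (α g b))]
  refine lintegral_congr fun x => ?_
  simp only [← mul_assoc]
  rw [← ENNReal.ofReal_mul (hp0 _).le, ← ENNReal.ofReal_mul (hpos _ _).le]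
  congr 2
  rw [skewCocycle]
  field_simp [(hp0 x).ne']

end SkewProduct

/-! ### Almost invariant functions of an ergodic action -/

section Ergodic

variable {Γ B : Type*} [Group Γ] [Countable Γ] [MulAction Γ B] [MeasurableSpace B]
  [MeasurableConstSMul Γ B]

/-- `IsErgodic` concerns strictly invariant sets. The points where all invariance equations hold
form such a set, and intersecting with it makes the level sets of `f` strictly invariant. -/
theorem IsErgodic.exists_ae_eq_const {η : Measure B} (hη : IsErgodic Γ η) {f : B → ℝ}
    (hf : Measurable f) (hinv : ∀ g : Γ, ∀ᵐ b ∂η, f (g • b) = f b) : ∃ c, ∀ᵐ b ∂η, f b = c := by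
  set V : Set B := {b | ∀ g : Γ, f (g • b) = f b} with hV
  have hVm : MeasurableSet V := by
    rw [hV, ofPred_forall]
    exact MeasurableSet.iInter fun g =>
      measurableSet_eq_fun (hf.comp (measurable_const_smul g)) hf
  have hVae : ∀ᵐ b ∂η, b ∈ V := ae_all_iff.mpr hinv
  have hVinv : ∀ (g : Γ) b, g • b ∈ V ↔ b ∈ V := by
    have h : ∀ (g : Γ) b, b ∈ V → g • b ∈ V := by
      intro g b hb h
      rw [smul_smul, hb, hb]
    exact fun g b => ⟨fun hb => by simpa using h g⁻¹ _ hb, h g b⟩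
  refine Filter.exists_eventuallyEq_const_of_forall_separating (l := ae η) (f := f) MeasurableSet
    fun U hU => ?_
  have hset : MeasurableSet (V ∩ f ⁻¹' U) := hVm.inter (hf hU)
  have hsetinv : ∀ g : Γ, (fun b => g • b) ⁻¹' (V ∩ f ⁻¹' U) = V ∩ f ⁻¹' U := by
    intro g
    ext b
    rw [mem_preimage, mem_inter_iff, mem_inter_iff, hVinv, mem_preimage, mem_preimage]
    refine and_congr_right fun hb => ?_
    rw [hb g]
  rcases hη _ hset hsetinv with h | h
  · right
    filter_upwards [hVae, measure_eq_zero_iff_ae_notMem.mp h] with b hb hb' hbU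
    exact hb' ⟨hb, hbU⟩
  · left
    filter_upwards [measure_eq_zero_iff_ae_notMem.mp h] with b hb
    exact (not_not.mp hb).2

end Ergodic

/-! ### Invariant functions over a coboundary component -/

section Fiber

variable {Γ B : Type*} [Group Γ] [Countable Γ] [MulAction Γ B] [MeasurableSpace B]
  [MeasurableConstSMul Γ B] {α : Γ → B → ℝ}

theorem measurePreserving_shear {η : Measure B} [IsProbabilityMeasure η] {L : B → ℝ}
    (hL : Measurable L) : MeasurePreserving (fun z : B × ℝ => (z.1, z.2 + L z.1))
      (η.prod volume) (η.prod volume) :=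
  (MeasurePreserving.id η).skew_product (g := fun b x => x + L b)
    (measurable_snd.add (hL.comp measurable_fst))
    (ae_of_all _ fun b => (measurePreserving_add_right volume (L b)).map_eq)

/-- If the cocycle is the coboundary of `exp ∘ L` on an ergodic measure, then invariant functions
on the skew product depend only on `x - L b`. -/
theorem ae_exists_const_of_invariant (hα : ∀ g, Measurable (α g)) (hpos : ∀ g b, 0 < α g b)
    (hcoc : ∀ g₁ g₂ b, α g₂ (g₁ • b) * α g₁ b = α (g₂ * g₁) b) {η : Measure B}
    [IsProbabilityMeasure η] (herg : IsErgodic Γ η) {L : B → ℝ} (hL : Measurable L)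
    (hcob : ∀ᵐ b ∂η, ∀ g : Γ, L (g • b) = L b - Real.log (α g b)) {u : B × ℝ → ℝ}
    (hu : Measurable u)
    (hinv : ∀ g : Γ, ∀ᵐ z ∂(η.prod volume), u (skewEquiv hα hpos hcoc g z) = u z) :
    ∀ᵐ y : ℝ, ∃ c, ∀ᵐ b ∂η, u (b, y + L b) = c := by
  have h1 : ∀ᵐ z ∂(η.prod volume), ∀ g : Γ, u (g • z.1, z.2 + L z.1 - Real.log (α g z.1)) =
      u (z.1, z.2 + L z.1) :=
    (measurePreserving_shear hL).quasiMeasurePreserving.ae (ae_all_iff.mpr hinv)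
  have h2 : ∀ᵐ z ∂(η.prod (volume : Measure ℝ)), ∀ g : Γ, L (g • z.1) =
      L z.1 - Real.log (α g z.1) :=
    Measure.quasiMeasurePreserving_fst.ae hcob
  have hshear : Measurable fun z : B × ℝ => u (z.1, z.2 + L z.1) :=
    hu.comp (measurePreserving_shear (η := η) hL).measurable
  have h3 : ∀ᵐ z ∂(η.prod (volume : Measure ℝ)), ∀ g : Γ,
      u (g • z.1, z.2 + L (g • z.1)) = u (z.1, z.2 + L z.1) := by
    filter_upwards [h1, h2] with z hz1 hz2 g
    rw [hz2 g, ← hz1 g, add_sub_assoc]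
  have hset : MeasurableSet {z : B × ℝ | ∀ g : Γ,
      u (g • z.1, z.2 + L (g • z.1)) = u (z.1, z.2 + L z.1)} := by
    rw [ofPred_forall]
    refine MeasurableSet.iInter fun g => measurableSet_eq_fun ?_ hshear
    exact hshear.comp (f := fun z : B × ℝ => (g • z.1, z.2))
      ((measurable_fst.const_smul g).prodMk measurable_snd)
  have h4 := (Measure.ae_prod_iff_ae_ae hset).mp h3
  have h5 := (Measure.ae_ae_comm hset).mp h4
  filter_upwards [h5] with y hy
  exact herg.exists_ae_eq_const (f := fun b => u (b, y + L b))
    (hshear.comp measurable_prodMk_right) (ae_all_iff.mp hy)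

/-- On the fibre `x = y + L b` the function `u` is constant. Orthogonality to invariant functions
fixes the constant: the integrals of `1_J` and of `u * p` along the fibre agree. -/
theorem ae_fiber_eq_div (hα : ∀ g, Measurable (α g)) (hpos : ∀ g b, 0 < α g b)
    (hcoc : ∀ g₁ g₂ b, α g₂ (g₁ • b) * α g₁ b = α (g₂ * g₁) b) {p : ℝ → ℝ} (hp : Measurable p)
    (hp0 : ∀ x, 0 < p x) (hpint : Integrable p) {η : Measure B}
    [IsProbabilityMeasure η] (herg : IsErgodic Γ η) {L : B → ℝ} (hL : Measurable L)
    {W : Set B} (hW : MeasurableSet W) (hWinv : ∀ (g : Γ) b, g • b ∈ W ↔ b ∈ W)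
    (hWae : ∀ᵐ b ∂η, b ∈ W)
    (hcob : ∀ b ∈ W, ∀ g : Γ, L (g • b) = L b - Real.log (α g b))
    {J : Set ℝ} (hJ : MeasurableSet J) {c : ℝ} (hc : 0 < c) (hJp : ∀ x ∈ J, c ≤ p x)
    {u : B × ℝ → ℝ} (hu : Measurable u)
    (huint : Integrable u (η.prod (volume.withDensity fun x => ENNReal.ofReal (p x))))
    (hinv : ∀ g : Γ, ∀ᵐ z ∂(η.prod (volume.withDensity fun x => ENNReal.ofReal (p x))),
      u (skewEquiv hα hpos hcoc g z) = u z)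
    (horth : ∀ k, IsBoundedInvariant (skewEquiv hα hpos hcoc) k →
      ∫ z, (J.indicator (fun x => (p x)⁻¹) z.2 - u z) * k z
        ∂(η.prod (volume.withDensity fun x => ENNReal.ofReal (p x))) = 0) :
    ∀ᵐ y : ℝ, 0 < ∫ b, p (y + L b) ∂η ∧ ∀ᵐ b ∂η,
      u (b, y + L b) = η.real {b | y + L b ∈ J} / ∫ b, p (y + L b) ∂η := by
  set q : ℝ → ℝ := J.indicator fun x => (p x)⁻¹ with hq
  have hpm : Measurable fun x => ENNReal.ofReal (p x) := hp.ennreal_ofReal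
  have hprod : η.prod (volume.withDensity fun x => ENNReal.ofReal (p x)) =
      (η.prod volume).withDensity fun z => ((p z.2).toNNReal : ℝ≥0∞) :=
    prod_withDensity_right hpm
  have hfin : IsFiniteMeasure (volume.withDensity fun x => ENNReal.ofReal (p x)) :=
    isFiniteMeasure_withDensity_ofReal hpint.2
  have hp2 : Measurable fun z : B × ℝ => (p z.2).toNNReal :=
    (hp.comp measurable_snd).real_toNNReal
  have hqm : Measurable q := hp.inv.indicator hJ
  have hqb : ∀ x, |q x| ≤ c⁻¹ := by
    intro x
    by_cases hx : x ∈ J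
    · rw [hq, indicator_of_mem hx, abs_of_pos (inv_pos.mpr (hp0 x))]
      exact inv_anti₀ hc (hJp x hx)
    · rw [hq, indicator_of_notMem hx, abs_zero]
      exact (inv_pos.mpr hc).le
  have hqp : ∀ x, q x * p x = J.indicator 1 x := by
    intro x
    by_cases hx : x ∈ J
    · rw [hq, indicator_of_mem hx, indicator_of_mem hx, inv_mul_cancel₀ (hp0 x).ne', Pi.one_apply]
    · rw [hq, indicator_of_notMem hx, indicator_of_notMem hx, zero_mul]
  have hshear := measurePreserving_shear (η := η) hL
  -- the invariant function is constant on the fibres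
  have hnull : η.prod (volume : Measure ℝ) ≪
      η.prod (volume.withDensity fun x => ENNReal.ofReal (p x)) := by
    refine Measure.AbsolutelyContinuous.rfl.prod ?_
    exact withDensity_absolutelyContinuous' hpm.aemeasurable
      (ae_of_all _ fun x => (ENNReal.ofReal_pos.mpr (hp0 x)).ne')
  have hconst := ae_exists_const_of_invariant hα hpos hcoc herg hL
    (hWae.mono fun b hb => hcob b hb) hu fun g => hnull.ae_le (hinv g)
  -- integrals against the sheared density
  set h : B × ℝ → ℝ := fun z => (q z.2 - u z) * p z.2 with hh
  have hqu : Integrable (fun z : B × ℝ => q z.2 - u z)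
      (η.prod (volume.withDensity fun x => ENNReal.ofReal (p x))) :=
    (integrable_of_bounded (hqm.comp measurable_snd) ⟨_, fun z => hqb z.2⟩).sub huint
  have hhint : Integrable h (η.prod volume) := by
    rw [hprod, integrable_withDensity_iff_integrable_smul hp2] at hqu
    refine hqu.congr (ae_of_all _ fun z => ?_)
    simp only [NNReal.smul_def, smul_eq_mul, Real.coe_toNNReal _ (hp0 z.2).le, hh, mul_comm]
  set Φ : B × ℝ → ℝ := fun z => h (z.1, z.2 + L z.1) with hΦ
  have hΦint : Integrable Φ (η.prod volume) := hshear.integrable_comp_of_integrable hhint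
  have hpint2 : Integrable (fun z : B × ℝ => p (z.2 + L z.1)) (η.prod volume) :=
    hshear.integrable_comp_of_integrable (g := fun z : B × ℝ => p z.2) (hpint.comp_snd η)
  have hΨ : ∀ᵐ y : ℝ, ∫ b, Φ (b, y) ∂η = 0 := by
    refine Integrable.ae_eq_zero_of_forall_setIntegral_eq_zero hΦint.integral_prod_right ?_
    intro K hK _
    -- The coordinate `x - L b` is invariant over `W`, so sets of its values provide test functions
    -- that localize the orthogonality in `y`.
    set V : Set (B × ℝ) := {z | z.1 ∈ W ∧ z.2 - L z.1 ∈ K} with hV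
    have hVm : MeasurableSet V := (measurable_fst hW).inter
      ((measurable_snd.sub (hL.comp measurable_fst)) hK)
    have hk : IsBoundedInvariant (skewEquiv hα hpos hcoc) (V.indicator 1 : B × ℝ → ℝ) := by
      refine ⟨measurable_one.indicator hVm, ⟨1, fun z => ?_⟩, fun g z => ?_⟩
      · by_cases hz : z ∈ V <;> simp [hz]
      · have hiff : skewEquiv hα hpos hcoc g z ∈ V ↔ z ∈ V := by
          change (g • z.1 ∈ W ∧ z.2 - Real.log (α g z.1) - L (g • z.1) ∈ K) ↔ _
          rw [hWinv]
          refine and_congr_right fun hz => ?_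
          rw [hcob _ hz, sub_sub_sub_cancel_right]
        by_cases hz : z ∈ V
        · rw [indicator_of_mem hz, indicator_of_mem (hiff.mpr hz)]; rfl
        · rw [indicator_of_notMem hz, indicator_of_notMem (mt hiff.mp hz)]
    have h0 := horth _ hk
    rw [hprod, integral_withDensity_eq_integral_smul hp2] at h0
    have h1 : ∫ z, V.indicator 1 z * h z ∂(η.prod volume) = 0 := by
      rw [← h0]
      refine integral_congr_ae (ae_of_all _ fun z => ?_)
      simp only [NNReal.smul_def, smul_eq_mul, Real.coe_toNNReal _ (hp0 z.2).le, hh]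
      ring
    have hVh : AEStronglyMeasurable (fun z => V.indicator 1 z * h z) (η.prod volume) :=
      (measurable_one.indicator hVm).aestronglyMeasurable.mul hhint.aestronglyMeasurable
    rw [← hshear.map_eq] at h1 hVh
    rw [integral_map hshear.measurable.aemeasurable hVh] at h1
    have hKΦ : Integrable (fun z : B × ℝ => K.indicator 1 z.2 * Φ z) (η.prod volume) := by
      refine (hΦint.indicator (measurable_snd hK)).congr (ae_of_all _ fun z => ?_)
      by_cases hz : z.2 ∈ K <;> simp [indicator, hz]
    calc ∫ y in K, ∫ b, Φ (b, y) ∂η = ∫ y, ∫ b, K.indicator 1 y * Φ (b, y) ∂η := by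
          rw [← integral_indicator hK]
          refine integral_congr_ae (ae_of_all _ fun y => ?_)
          by_cases hy : y ∈ K <;> simp [hy]
      _ = ∫ z, K.indicator 1 z.2 * Φ z ∂(η.prod volume) := (integral_prod_symm _ hKΦ).symm
      _ = 0 := by
          rw [← h1]
          refine integral_congr_ae ?_
          filter_upwards [Measure.quasiMeasurePreserving_fst.ae hWae] with z hz
          have hiff : (z.1, z.2 + L z.1) ∈ V ↔ z.2 ∈ K := by
            change (z.1 ∈ W ∧ z.2 + L z.1 - L z.1 ∈ K) ↔ _
            rw [add_sub_cancel_right]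
            exact and_iff_right hz
          by_cases hzK : z.2 ∈ K
          · simp only [indicator_of_mem hzK, indicator_of_mem (hiff.mpr hzK), hΦ, Pi.one_apply]
          · simp only [indicator_of_notMem hzK, indicator_of_notMem (mt hiff.mp hzK), zero_mul]
  filter_upwards [hΨ, hconst, hpint2.prod_left_ae] with y hy ⟨a, ha⟩ hpy
  have hN : 0 < ∫ b, p (y + L b) ∂η := by
    rw [integral_pos_iff_support_of_nonneg (fun b => (hp0 _).le) hpy]
    have : (Function.support fun b => p (y + L b)) = univ :=
      eq_univ_of_forall fun b => (hp0 _).ne'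
    rw [this]
    simp
  refine ⟨hN, ha.mono fun b hb => ?_⟩
  have hJy : MeasurableSet {b | y + L b ∈ J} := (measurable_const.add hL) hJ
  have h1 : ∫ b, Φ (b, y) ∂η =
      ∫ b, ({b | y + L b ∈ J}.indicator 1 b - a * p (y + L b)) ∂η := by
    refine integral_congr_ae (ha.mono fun b hb => ?_)
    simp only [hΦ, hh, hb, sub_mul, hqp]
    rfl
  have h2 : Integrable ({b | y + L b ∈ J}.indicator (1 : B → ℝ)) η :=
    (integrable_const (1 : ℝ)).indicator hJy
  rw [h1, integral_sub h2 (hpy.const_mul a),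
    integral_indicator_one hJy, integral_const_mul, sub_eq_zero] at hy
  rw [hb, hy, mul_div_cancel_right₀ _ hN.ne']

end Fiber

/-! ### Bounded returns make the cocycle a coboundary -/

section Coboundary

variable {Γ B : Type*} [Group Γ] [MulAction Γ B]

/-- The supremum of the cocycle over all moves of `b` into `A`. -/
noncomputable def returnSup (α : Γ → B → ℝ) (A : Set B) (b : B) : ℝ≥0∞ :=
  ⨆ g : Γ, {b | g • b ∈ A}.indicator (fun b => ENNReal.ofReal (α g b)) b

theorem measurable_returnSup [Countable Γ] [MeasurableSpace B] [MeasurableConstSMul Γ B]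
    {α : Γ → B → ℝ} (hα : ∀ g, Measurable (α g)) {A : Set B} (hA : MeasurableSet A) :
    Measurable (returnSup α A) :=
  Measurable.iSup fun g => (hα g).ennreal_ofReal.indicator (measurable_const_smul g hA)

/-- The moves from `b` into `A` are those from `g • b` preceded by `g`, so the supremum rescales by
`α g b`; its logarithm is the transfer function. -/
theorem returnSup_smul_mul {α : Γ → B → ℝ} (hpos : ∀ g b, 0 < α g b)
    (hcoc : ∀ g₁ g₂ b, α g₂ (g₁ • b) * α g₁ b = α (g₂ * g₁) b) (A : Set B) (g : Γ) (b : B) :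
    returnSup α A (g • b) * ENNReal.ofReal (α g b) = returnSup α A b := by
  rw [returnSup, ENNReal.iSup_mul]
  refine (Equiv.mulRight g).iSup_congr fun h => ?_
  rw [Equiv.coe_mulRight]
  by_cases hh : h • g • b ∈ A
  · rw [indicator_of_mem (show g • b ∈ {b | h • b ∈ A} from hh), indicator_of_mem
      (show b ∈ {b | (h * g) • b ∈ A} by rwa [mem_ofPred_eq, mul_smul]),
      ← ENNReal.ofReal_mul (hpos _ _).le, hcoc]
  · rw [indicator_of_notMem (show g • b ∉ {b | h • b ∈ A} from hh), indicator_of_notMem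
      (show b ∉ {b | (h * g) • b ∈ A} by rwa [mem_ofPred_eq, mul_smul]), zero_mul]

theorem returnSup_pos {α : Γ → B → ℝ} (hpos : ∀ g b, 0 < α g b) {A : Set B} {b : B} {g : Γ}
    (hg : g • b ∈ A) : 0 < returnSup α A b := by
  refine lt_of_lt_of_le (ENNReal.ofReal_pos.mpr (hpos g b)) ?_
  refine le_trans ?_ (le_iSup _ g)
  rw [indicator_of_mem (show b ∈ {b | g • b ∈ A} from hg)]

theorem returnSup_lt_top {α : Γ → B → ℝ} (hpos : ∀ g b, 0 < α g b)
    (hcoc : ∀ g₁ g₂ b, α g₂ (g₁ • b) * α g₁ b = α (g₂ * g₁) b) {n : ℝ} {A : Set B}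
    (hA : IsLacunary α (Ioi n) A) {b : B} {g : Γ} (hg : g • b ∈ A) : returnSup α A b < ∞ := by
  rw [← returnSup_smul_mul hpos hcoc A g b]
  -- Lacunarity bounds nontrivial moves by `n`; the trivial move contributes `1`.
  refine ENNReal.mul_lt_top (lt_of_le_of_lt ?_ (ENNReal.ofReal_lt_top (r := max n 1)))
    ENNReal.ofReal_lt_top
  refine iSup_le fun h => ?_
  by_cases hh : h • g • b ∈ A
  · rw [indicator_of_mem (show g • b ∈ {b | h • b ∈ A} from hh)]
    refine ENNReal.ofReal_le_ofReal ?_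
    by_cases h1 : h = 1
    · rw [h1, cocycle_one hpos hcoc]
      exact le_max_right _ _
    · exact (not_lt.mp (hA _ hg h h1 hh)).trans (le_max_left _ _)
  · rw [indicator_of_notMem (show g • b ∉ {b | h • b ∈ A} from hh)]
    exact zero_le

/-- If large cocycle values are not recurrent for an ergodic measure, then the cocycle is a
coboundary. -/
theorem exists_coboundary [Countable Γ] [MeasurableSpace B] [MeasurableConstSMul Γ B]
    {α : Γ → B → ℝ} (hα : ∀ g, Measurable (α g)) (hpos : ∀ g b, 0 < α g b)
    (hcoc : ∀ g₁ g₂ b, α g₂ (g₁ • b) * α g₁ b = α (g₂ * g₁) b) {η : Measure B}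
    (herg : IsErgodic Γ η) {n : ℝ} (hn : ¬ IsRecurrent η α (Ioi n)) :
    ∃ L : B → ℝ, Measurable L ∧ ∃ W : Set B, MeasurableSet W ∧
      (∀ (g : Γ) b, g • b ∈ W ↔ b ∈ W) ∧ (∀ᵐ b ∂η, b ∈ W) ∧
      ∀ b ∈ W, ∀ g : Γ, L (g • b) = L b - Real.log (α g b) := by
  unfold IsRecurrent at hn
  push Not at hn
  obtain ⟨A, hA, hlac, hηA⟩ := hn
  -- The saturation of `A` is invariant and not null, hence conull by ergodicity.
  set W : Set B := ⋃ g : Γ, {b | g • b ∈ A} with hW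
  have hWm : MeasurableSet W := MeasurableSet.iUnion fun g => measurable_const_smul g hA
  have hWinv : ∀ (g : Γ) b, g • b ∈ W ↔ b ∈ W := by
    intro g b
    simp only [hW, mem_iUnion, mem_ofPred_eq, smul_smul]
    exact (Equiv.mulRight g).exists_congr fun h => by rw [Equiv.coe_mulRight]
  refine ⟨fun b => Real.log (returnSup α A b).toReal,
    Real.measurable_log.comp (measurable_returnSup hα hA).ennreal_toReal, W, hWm, hWinv, ?_, ?_⟩
  · rcases herg W hWm fun g => Set.ext fun b => hWinv g b with h | h
    · refine absurd (measure_mono_null (fun b hb => ?_) h) hηA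
      exact mem_iUnion.mpr ⟨1, by simpa using hb⟩
    · exact mem_ae_iff.mpr h
  · intro b hb g
    obtain ⟨h, hh⟩ := mem_iUnion.mp ((hWinv g b).mpr hb)
    replace hh : h • g • b ∈ A := hh
    have h1 : (returnSup α A (g • b)).toReal ≠ 0 :=
      (ENNReal.toReal_pos (returnSup_pos hpos hh).ne' (returnSup_lt_top hpos hcoc hlac hh).ne).ne'
    simp only
    rw [← returnSup_smul_mul hpos hcoc A g b, ENNReal.toReal_mul,
      ENNReal.toReal_ofReal (hpos g b).le, Real.log_mul h1 (hpos g b).ne', add_sub_cancel_right]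

end Coboundary

/-! ### Medians and endpoints of rays -/

section RayEndpoint

variable {B : Type*} [MeasurableSpace B]

/-- The left endpoint of the ray `{x | (b, x) ∈ S}`, defined through Lebesgue measure. -/
noncomputable def rayEndpoint (S : Set (B × ℝ)) (b : B) : ℝ :=
  volume.real {x : ℝ | 0 < x ∧ (b, x) ∉ S} - volume.real {x : ℝ | x ≤ 0 ∧ (b, x) ∈ S}

theorem measurable_rayEndpoint {S : Set (B × ℝ)} (hS : MeasurableSet S) :
    Measurable (rayEndpoint S) := by
  refine Measurable.sub ?_ ?_
  · exact (measurable_measure_prodMk_left (ν := (volume : Measure ℝ))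
      (s := {z : B × ℝ | 0 < z.2 ∧ z ∉ S})
      ((measurable_snd measurableSet_Ioi).inter hS.compl)).ennreal_toReal
  · exact (measurable_measure_prodMk_left (ν := (volume : Measure ℝ))
      (s := {z : B × ℝ | z.2 ≤ 0 ∧ z ∈ S})
      ((measurable_snd measurableSet_Iic).inter hS)).ennreal_toReal

-- The two volumes are the positive and negative parts of `a`. They ignore null sets, so knowing the
-- fibre almost everywhere is enough.
omit [MeasurableSpace B] in
theorem rayEndpoint_eq {S : Set (B × ℝ)} {b : B} {a : ℝ}
    (h : ∀ᵐ x : ℝ, (b, x) ∈ S ↔ a < x) : rayEndpoint S b = a := by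
  have h1 : ({x : ℝ | 0 < x ∧ (b, x) ∉ S} : Set ℝ) =ᵐ[volume] Ioc 0 a := by
    filter_upwards [h] with x hx
    exact propext (and_congr_right fun _ => (not_congr hx).trans not_lt)
  have h2 : ({x : ℝ | x ≤ 0 ∧ (b, x) ∈ S} : Set ℝ) =ᵐ[volume] Ioc a 0 := by
    filter_upwards [h] with x hx
    exact propext ((and_congr_right fun _ => hx).trans and_comm)
  rw [rayEndpoint, measureReal_congr h1, measureReal_congr h2, Real.volume_real_Ioc,
    Real.volume_real_Ioc]
  rcases le_total 0 a with ha | ha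
  · rw [max_eq_left (by linarith), max_eq_right (by linarith)]; ring
  · rw [max_eq_right (by linarith), max_eq_left (by linarith)]; ring

/-- The upper half of the distribution of a real random variable determines a ray. -/
theorem exists_ae_half_lt_iff {η : Measure B} [IsProbabilityMeasure η] {L : B → ℝ}
    (hL : Measurable L) :
    ∃ y₀ : ℝ, ∀ᵐ y : ℝ, (1 / 2 : ℝ≥0∞) < η {b | 0 < y + L b} ↔ y₀ < y := by
  set Y : Set ℝ := {y | (1 / 2 : ℝ≥0∞) < η {b | 0 < y + L b}} with hY
  have hmono : Monotone fun y : ℝ => η {b | 0 < y + L b} := fun y y' hyy' =>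
    measure_mono fun b (hb : 0 < y + L b) => lt_of_lt_of_le hb (by gcongr)
  have hnm : ∀ y : ℝ, MeasurableSet {b | 0 < y + L b} := fun y =>
    measurableSet_lt measurable_const (measurable_const.add hL)
  have htop : ∃ y, y ∈ Y := by
    have hlim : Tendsto (fun n : ℕ => η {b | 0 < (n : ℝ) + L b}) atTop
        (𝓝 (η (⋃ n : ℕ, {b | 0 < (n : ℝ) + L b}))) :=
      tendsto_measure_iUnion_atTop fun m n hmn b (hb : 0 < (m : ℝ) + L b) =>
        lt_of_lt_of_le hb (by gcongr)
    have huniv : (⋃ n : ℕ, {b | 0 < (n : ℝ) + L b}) = univ := by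
      refine eq_univ_of_forall fun b => mem_iUnion.mpr ?_
      obtain ⟨n, hn⟩ := exists_nat_gt (-L b)
      exact ⟨n, by rw [mem_ofPred_eq]; linarith⟩
    rw [huniv, measure_univ] at hlim
    obtain ⟨n, hn⟩ := (hlim.eventually_const_lt
      (show (1 / 2 : ℝ≥0∞) < 1 by rw [one_div]; exact ENNReal.one_half_lt_one)).exists
    exact ⟨n, hn⟩
  have hbot : ∃ y, y ∉ Y := by
    have hlim : Tendsto (fun n : ℕ => η {b | 0 < -(n : ℝ) + L b}) atTop
        (𝓝 (η (⋂ n : ℕ, {b | 0 < -(n : ℝ) + L b}))) :=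
      tendsto_measure_iInter_atTop (fun n => (hnm _).nullMeasurableSet)
        (fun m n hmn b (hb : 0 < -(n : ℝ) + L b) => lt_of_lt_of_le hb (by gcongr))
        ⟨0, measure_ne_top _ _⟩
    have hempty : (⋂ n : ℕ, {b | 0 < -(n : ℝ) + L b}) = ∅ := by
      refine eq_empty_of_forall_notMem fun b hb => ?_
      obtain ⟨n, hn⟩ := exists_nat_gt (L b)
      have : 0 < -(n : ℝ) + L b := mem_iInter.mp hb n
      linarith
    rw [hempty, measure_empty] at hlim
    obtain ⟨n, hn⟩ := (hlim.eventually_lt_const (show (0 : ℝ≥0∞) < 1 / 2 by simp)).exists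
    exact ⟨-n, not_lt.mpr hn.le⟩
  obtain ⟨y₁, hy₁⟩ := hbot
  have hbdd : BddBelow Y := ⟨y₁, fun y hy => by
    by_contra! h
    exact hy₁ (lt_of_lt_of_le hy (hmono h.le))⟩
  refine ⟨sInf Y, ?_⟩
  -- By monotonicity `Y` is an upper ray; whether it contains its endpoint is irrelevant almost
  -- everywhere.
  filter_upwards [measure_eq_zero_iff_ae_notMem.mp (Real.volume_singleton (a := sInf Y))]
    with y hy
  constructor
  · exact fun h => lt_of_le_of_ne (csInf_le hbdd h) fun heq => hy heq.symm
  · intro h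
    obtain ⟨y', hy', hlt⟩ := exists_lt_of_csInf_lt htop h
    exact lt_of_lt_of_le hy' (hmono hlt.le)

end RayEndpoint

/-! ### Large cocycle values on the components -/

section Components

variable {Γ B : Type*} [Group Γ] [Countable Γ] [MulAction Γ B] [MeasurableSpace B]
  [MeasurableConstSMul Γ B] {α : Γ → B → ℝ}

/-- The projections of `exists_ae_invariant_projection` for the skew product action. -/
theorem exists_ae_skew_projection (hα : ∀ g, Measurable (α g)) (hpos : ∀ g b, 0 < α g b)
    (hcoc : ∀ g₁ g₂ b, α g₂ (g₁ • b) * α g₁ b = α (g₂ * g₁) b) {ω : Measure (Measure B)}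
    [IsProbabilityMeasure ω.join] (hν : IsQuasiInvariant Γ ω.join) (hνα : AgreesWithRN ω.join α)
    (hω : ∀ᵐ η ∂ω, IsProbabilityMeasure η ∧ IsQuasiInvariant Γ η ∧ AgreesWithRN η α)
    {p : ℝ → ℝ} (hp : Measurable p) (hp0 : ∀ x, 0 < p x)
    [hprob : IsProbabilityMeasure (volume.withDensity fun x => ENNReal.ofReal (p x))]
    {q : ℝ → ℝ} (hq : Measurable q) (hqb : ∃ C, ∀ x, |q x| ≤ C) :
    ∃ u : B × ℝ → ℝ, Measurable u ∧ ∀ᵐ η ∂ω,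
      Integrable u (η.prod (volume.withDensity fun x => ENNReal.ofReal (p x))) ∧
      (∀ g : Γ, ∀ᵐ z ∂(η.prod (volume.withDensity fun x => ENNReal.ofReal (p x))),
        u (skewEquiv hα hpos hcoc g z) = u z) ∧
      ∀ k, IsBoundedInvariant (skewEquiv hα hpos hcoc) k →
        ∫ z, (q z.2 - u z) * k z
          ∂(η.prod (volume.withDensity fun x => ENNReal.ofReal (p x))) = 0 := by
  set ρ : Measure ℝ := volume.withDensity fun x => ENNReal.ofReal (p x) with hρ
  have hκ : Measurable fun b : B => ρ.map (Prod.mk b) := Measurable.map_prodMk_left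
  have hprodbind : ∀ η : Measure B, η.prod ρ = η.bind fun b => ρ.map (Prod.mk b) := fun η => by
    rw [Measure.prod]
  have hK : Measurable fun η : Measure B => η.prod ρ := by
    simp only [hprodbind]
    exact Measure.measurable_bind' hκ
  have hbind : ω.bind (fun η => η.prod ρ) = ω.join.prod ρ := by
    simp only [hprodbind]
    rw [Measure.join_eq_bind, Measure.bind_bind aemeasurable_id hκ.aemeasurable]
    rfl
  have hbindprob : IsProbabilityMeasure (ω.bind fun η => η.prod ρ) := by
    rw [hbind]; infer_instance
  have hset : ∀ᵐ η ∂ω, IsProbabilityMeasure (η.prod ρ) ∧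
      IsCocycleMeasure (skewEquiv hα hpos hcoc) (skewCocycle α p) (η.prod ρ) := by
    filter_upwards [hω] with η ⟨h1, h2, h3⟩
    exact ⟨inferInstance, isCocycleMeasure_prod hα hpos hcoc hp hp0 h2 h3⟩
  have hM : IsCocycleMeasure (skewEquiv hα hpos hcoc) (skewCocycle α p)
      (ω.bind fun η => η.prod ρ) := by
    rw [hbind]
    exact isCocycleMeasure_prod hα hpos hcoc hp hp0 hν hνα
  obtain ⟨C, hC⟩ := hqb
  exact exists_ae_invariant_projection hK (measurable_skewCocycle hα hp)
    (skewCocycle_pos hpos hp0) hM hset (ξ := fun z => q z.2) (hq.comp measurable_snd)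
    ⟨C, fun z => hC z.2⟩

/-- On almost every ergodic component on which large cocycle values are not recurrent, the
cocycle is the coboundary of one and the same Borel function. -/
theorem exists_ae_coboundary (hα : ∀ g, Measurable (α g)) (hpos : ∀ g b, 0 < α g b)
    (hcoc : ∀ g₁ g₂ b, α g₂ (g₁ • b) * α g₁ b = α (g₂ * g₁) b) {ω : Measure (Measure B)}
    [IsProbabilityMeasure ω.join] (hν : IsQuasiInvariant Γ ω.join) (hνα : AgreesWithRN ω.join α)
    (hω : ∀ᵐ η ∂ω, IsProbabilityMeasure η ∧ IsQuasiInvariant Γ η ∧ AgreesWithRN η α)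
    (hωerg : ∀ᵐ η ∂ω, IsErgodic Γ η) :
    ∃ M : B → ℝ, Measurable M ∧ ∀ᵐ η ∂ω, (∃ n : ℝ, ¬ IsRecurrent η α (Ioi n)) →
      ∀ᵐ b ∂η, ∀ g : Γ, M (g • b) = M b - Real.log (α g b) := by
  set p : ℝ → ℝ := ProbabilityTheory.gaussianPDFReal 0 1 with hpdef
  have hp : Measurable p := ProbabilityTheory.measurable_gaussianPDFReal 0 1
  have hp0 : ∀ x, 0 < p x := fun x => ProbabilityTheory.gaussianPDFReal_pos 0 1 x one_ne_zero
  have hpint : Integrable p := ProbabilityTheory.integrable_gaussianPDFReal 0 1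
  have hprob : IsProbabilityMeasure (volume.withDensity fun x => ENNReal.ofReal (p x)) := by
    refine ⟨?_⟩
    rw [withDensity_apply _ .univ, setLIntegral_univ]
    exact ProbabilityTheory.lintegral_gaussianPDFReal_eq_one 0 one_ne_zero
  -- On `I n` the function `1 / p` is bounded by `n + 1`, as the projection requires; the sets
  -- exhaust `ℝ`.
  set I : ℕ → Set ℝ := fun n => {x | ((n : ℝ) + 1)⁻¹ ≤ p x} with hI
  have hIm : ∀ n, MeasurableSet (I n) := fun n => measurableSet_le measurable_const hp
  have hImono : Monotone I := fun m n hmn x (hx : ((m : ℝ) + 1)⁻¹ ≤ p x) =>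
    le_trans (by gcongr) hx
  have hIuniv : ⋃ n, I n = univ := by
    refine eq_univ_of_forall fun x => mem_iUnion.mpr ?_
    obtain ⟨n, hn⟩ := exists_nat_gt (p x)⁻¹
    exact ⟨n, inv_le_of_inv_le₀ (hp0 x) (by linarith)⟩
  have hc : ∀ n : ℕ, 0 < ((n : ℝ) + 1)⁻¹ := fun n => by positivity
  -- conditional expectations of `1_J / p`
  have hproj : ∀ (n : ℕ) (J : Set ℝ), MeasurableSet J → J ⊆ I n →
      ∃ u : B × ℝ → ℝ, Measurable u ∧ ∀ᵐ η ∂ω, ∀ (L : B → ℝ) (W : Set B), Measurable L →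
        MeasurableSet W → (∀ (g : Γ) b, g • b ∈ W ↔ b ∈ W) → (∀ᵐ b ∂η, b ∈ W) →
        (∀ b ∈ W, ∀ g : Γ, L (g • b) = L b - Real.log (α g b)) →
        ∀ᵐ y : ℝ, 0 < ∫ b, p (y + L b) ∂η ∧ ∀ᵐ b ∂η,
          u (b, y + L b) = η.real {b | y + L b ∈ J} / ∫ b, p (y + L b) ∂η := by
    intro n J hJ hJI
    have hqb : ∃ C, ∀ x, |J.indicator (fun x => (p x)⁻¹) x| ≤ C := by
      refine ⟨(n : ℝ) + 1, fun x => ?_⟩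
      by_cases hx : x ∈ J
      · rw [indicator_of_mem hx, abs_of_pos (inv_pos.mpr (hp0 x))]
        exact inv_le_of_inv_le₀ (by positivity) (hJI hx)
      · rw [indicator_of_notMem hx, abs_zero]
        positivity
    obtain ⟨u, hu, hae⟩ := exists_ae_skew_projection hα hpos hcoc hν hνα hω hp hp0
      (q := J.indicator fun x => (p x)⁻¹) (hp.inv.indicator hJ) hqb
    refine ⟨u, hu, ?_⟩
    filter_upwards [hae, hω, hωerg] with η ⟨h1, h2, h3⟩ ⟨hη, _, _⟩ herg L W hL hW hWinv hWae hcob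
    exact ae_fiber_eq_div hα hpos hcoc hp hp0 hpint herg hL hW hWinv hWae hcob hJ (hc n)
      (fun x hx => hJI hx) hu h1 h2 h3
  choose u hu huae using fun n => hproj n (I n) (hIm n) le_rfl
  choose v hv hvae using fun n => hproj n (I n ∩ Ioi 0) ((hIm n).inter measurableSet_Ioi)
    inter_subset_left
  -- The unknown normalization `∫ p (y + L)` cancels in the quotient. Over a coboundary component
  -- the limit is `η {0 < y + L}`; `limsup` makes `G` defined and measurable everywhere, without
  -- reference to `η` or `L`.
  set G : B × ℝ → ℝ≥0∞ := fun z => limsup (fun n => ENNReal.ofReal (v n z / u n z)) atTop with hG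
  have hGm : Measurable G :=
    Measurable.limsup fun n => ((hv n).div (hu n)).ennreal_ofReal
  set S : Set (B × ℝ) := {z | (1 / 2 : ℝ≥0∞) < G z} with hS
  have hSm : MeasurableSet S := measurableSet_lt measurable_const hGm
  refine ⟨rayEndpoint S, measurable_rayEndpoint hSm, ?_⟩
  filter_upwards [ae_all_iff.mpr huae, ae_all_iff.mpr hvae, hω, hωerg]
    with η hηu hηv ⟨hη, hq, _⟩ herg ⟨n, hn⟩
  obtain ⟨L, hL, W, hW, hWinv, hWae, hcob⟩ := exists_coboundary hα hpos hcoc herg hn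
  obtain ⟨y₀, hy₀⟩ := exists_ae_half_lt_iff (η := η) hL
  have hfib : ∀ᵐ y : ℝ, ∀ᵐ b ∂η, (b, y + L b) ∈ S ↔ y₀ < y := by
    filter_upwards [ae_all_iff.mpr fun n => hηu n L W hL hW hWinv hWae hcob,
      ae_all_iff.mpr fun n => hηv n L W hL hW hWinv hWae hcob, hy₀] with y hyu hyv hy
    filter_upwards [ae_all_iff.mpr fun n => (hyu n).2, ae_all_iff.mpr fun n => (hyv n).2]
      with b hbu hbv
    have hlim : ∀ K : Set ℝ, Tendsto (fun n => η {b | y + L b ∈ I n ∩ K}) atTop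
        (𝓝 (η {b | y + L b ∈ K})) := by
      intro K
      have hunion : {b | y + L b ∈ K} = ⋃ n, {b | y + L b ∈ I n ∩ K} := by
        ext b
        obtain ⟨n, hn⟩ := mem_iUnion.mp (hIuniv.symm ▸ mem_univ (y + L b))
        simp only [mem_iUnion, mem_ofPred_eq, mem_inter_iff]
        exact ⟨fun h => ⟨n, hn, h⟩, fun ⟨_, h⟩ => h.2⟩
      rw [hunion]
      exact tendsto_measure_iUnion_atTop fun m n hmn b hb => ⟨hImono hmn hb.1, hb.2⟩
    have hlimR : ∀ K : Set ℝ, Tendsto (fun n => η.real {b | y + L b ∈ I n ∩ K}) atTop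
        (𝓝 (η.real {b | y + L b ∈ K})) := fun K =>
      (ENNReal.tendsto_toReal (measure_ne_top _ _)).comp (hlim K)
    have hratio : ∀ n, v n (b, y + L b) / u n (b, y + L b) =
        η.real {b | y + L b ∈ I n ∩ Ioi 0} / η.real {b | y + L b ∈ I n ∩ univ} := by
      intro n
      rw [hbu n, hbv n, div_div_div_cancel_right₀ (hyu n).1.ne', inter_univ]
    have hGlim : Tendsto (fun n => ENNReal.ofReal (v n (b, y + L b) / u n (b, y + L b))) atTop
        (𝓝 (η {b | 0 < y + L b})) := by
      simp only [hratio]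
      have h1 := (hlimR (Ioi 0)).div (hlimR univ) (by simp)
      have h2 := (ENNReal.continuous_ofReal.tendsto _).comp h1
      rw [show η.real {b | y + L b ∈ univ} = 1 by simp, div_one, ofReal_measureReal] at h2
      exact h2
    rw [← hy, hS, mem_ofPred_eq, show G (b, y + L b) = _ from hGlim.limsup_eq]
  have hset : MeasurableSet {z : B × ℝ | (z.1, z.2 + L z.1) ∈ S ↔ y₀ < z.2} := by
    refine MeasurableSet.iff ?_ (measurable_snd measurableSet_Ioi)
    exact (measurePreserving_shear (η := η) hL).measurable hSm
  have hM : ∀ᵐ b ∂η, rayEndpoint S b = y₀ + L b := by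
    filter_upwards [(Measure.ae_ae_comm (ν := (volume : Measure ℝ)) hset).mpr hfib] with b hb
    refine rayEndpoint_eq ?_
    filter_upwards [(measurePreserving_sub_right volume (L b)).quasiMeasurePreserving.ae hb]
      with x hx
    rw [sub_add_cancel] at hx
    rw [hx, lt_sub_iff_add_lt]
  -- Quasi-invariance carries the almost sure identity to all translates, where the constant `y₀`
  -- cancels.
  have hMg : ∀ᵐ b ∂η, ∀ g : Γ, rayEndpoint S (g • b) = y₀ + L (g • b) :=
    ae_all_iff.mpr fun g => ae_of_ae_map (measurable_const_smul g).aemeasurable ((hq g).ae_le hM)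
  filter_upwards [hM, hMg, hWae] with b h1 h2 h3 g
  rw [h2 g, h1, hcob b h3 g, add_sub_assoc]

/-- If large cocycle values are recurrent for the mixture, they are so for almost every ergodic
component. -/
theorem ae_forall_isRecurrent_Ioi (hα : ∀ g, Measurable (α g)) (hpos : ∀ g b, 0 < α g b)
    (hcoc : ∀ g₁ g₂ b, α g₂ (g₁ • b) * α g₁ b = α (g₂ * g₁) b) {ω : Measure (Measure B)}
    [IsProbabilityMeasure ω.join] (hν : IsQuasiInvariant Γ ω.join) (hνα : AgreesWithRN ω.join α)
    (hω : ∀ᵐ η ∂ω, IsProbabilityMeasure η ∧ IsQuasiInvariant Γ η ∧ AgreesWithRN η α)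
    (hωerg : ∀ᵐ η ∂ω, IsErgodic Γ η) (h : ∀ n : ℝ, 0 < n → IsRecurrent ω.join α (Ioi n)) :
    ∀ᵐ η ∂ω, ∀ n : ℝ, IsRecurrent η α (Ioi n) := by
  obtain ⟨M, hM, hMae⟩ := exists_ae_coboundary hα hpos hcoc hν hνα hω hωerg
  set C : Set B := {b | ∀ g : Γ, M (g • b) = M b - Real.log (α g b)} with hC
  have hCm : MeasurableSet C := by
    rw [hC, ofPred_forall]
    exact MeasurableSet.iInter fun g => measurableSet_eq_fun
      (hM.comp (measurable_const_smul g)) (hM.sub (Real.measurable_log.comp (hα g)))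
  -- Between two points of one slice `M` changes by less than `1`, so no return has cocycle value
  -- above `e`.
  have hslice : ∀ j : ℤ, ω.join (C ∩ M ⁻¹' Ico (j : ℝ) (j + 1)) = 0 := by
    intro j
    refine h (Real.exp 1) (Real.exp_pos 1) _ (hCm.inter (hM measurableSet_Ico)) ?_
    rintro b ⟨hbC, hb⟩ g - ⟨-, hgb⟩ hlt
    have h1 : 1 < Real.log (α g b) := (Real.lt_log_iff_exp_lt (hpos g b)).mpr hlt
    rw [mem_preimage, hbC g] at hgb
    have h2 := hgb.1
    have h3 := (show M b ∈ Ico (j : ℝ) (j + 1) from hb).2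
    linarith
  have hC0 : ω.join C = 0 := by
    have hunion : C = ⋃ j : ℤ, C ∩ M ⁻¹' Ico (j : ℝ) (j + 1) := by
      rw [← inter_iUnion, ← preimage_iUnion, iUnion_Ico_intCast, preimage_univ, inter_univ]
    rw [hunion]
    exact measure_iUnion_null hslice
  rw [Measure.join_apply hCm, lintegral_eq_zero_iff (Measure.measurable_coe hCm)] at hC0
  filter_upwards [hMae, hC0, hω] with η hη hηC ⟨hηp, _, _⟩ n
  by_contra hn
  have hae : ∀ᵐ b ∂η, b ∈ C := hη ⟨n, hn⟩
  exact hηp.ne_zero _ (ae_eq_bot.mp (eventually_false_iff_eq_bot.mp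
    (hae.and (measure_eq_zero_iff_ae_notMem.mp hηC) |>.mono fun b hb => hb.2 hb.1)))

end Components

end RatioSet

/-! ### The theorem, by the cases `∞`, `0` and `0 < t < ∞` -/

theorem theorem2p1 {Γ B : Type*} [Group Γ] [Countable Γ] [MeasurableSpace B] [StandardBorelSpace B]
    [MulAction Γ B] [MeasurableConstSMul Γ B]
    (ν : Measure B) [IsProbabilityMeasure ν] (hν : RatioSet.IsQuasiInvariant Γ ν)
    (α : Γ → B → ℝ) (hα : RatioSet.IsRNCocycle ν α)
    (ω : Measure (Measure B)) (hω : RatioSet.IsErgodicDecomposition ν α ω)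
    (t : ℝ≥0∞) :
    t ∈ RatioSet.ratioSet Γ ν ↔ ∀ᵐ η ∂ω, t ∈ RatioSet.ratioSet Γ η := by
  open RatioSet in
  obtain rfl : ν = ω.join := Measure.ext fun A hA => by
    rw [hω.barycenter A hA, Measure.join_apply hA]
  obtain ⟨hαm, hpos, hcoc, hνα⟩ := hα
  have hq : ∀ᵐ η ∂ω, IsProbabilityMeasure η ∧ IsQuasiInvariant Γ η ∧ AgreesWithRN η α := by
    filter_upwards [hω.ergodic, hω.agrees] with η h1 h2
    exact ⟨h1.1, h1.2.1, h2⟩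
  have herg : ∀ᵐ η ∂ω, IsErgodic Γ η := hω.ergodic.mono fun η h => h.2.2
  have hinf : IsInfiniteRatio Γ ω.join ↔ ∀ᵐ η ∂ω, IsInfiniteRatio Γ η := by
    have hiff : ∀ᵐ η ∂ω, IsInfiniteRatio Γ η ↔ ∀ n : ℝ, 0 < n → IsRecurrent η α (Set.Ioi n) :=
      hq.mono fun η h => isInfiniteRatio_iff_isRecurrent hαm hpos h.2.2
    rw [isInfiniteRatio_iff_isRecurrent hαm hpos hνα, Filter.eventually_congr hiff]
    constructor
    · intro h
      exact (ae_forall_isRecurrent_Ioi hαm hpos hcoc hν hνα hq herg h).mono fun η hη n _ => hη n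
    · exact fun h n hn => isRecurrent_join_of_ae (h.mono fun η hη => hη n hn)
  by_cases htop : t = ∞
  · simpa [ratioSet, htop] using hinf
  have hmem : ∀ η : Measure B, t ∈ ratioSet Γ η ↔ IsFiniteRatio Γ η t.toReal := fun η => by
    simp [ratioSet, htop]
  simp only [hmem]
  rcases ENNReal.toReal_nonneg (a := t) |>.eq_or_lt with h0 | h0
  · rw [← h0, isFiniteRatio_zero_iff_isInfiniteRatio hαm hpos hcoc hνα, hinf]
    exact Filter.eventually_congr (hq.mono fun η h =>
      (isFiniteRatio_zero_iff_isInfiniteRatio hαm hpos hcoc h.2.2).symm)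
  · set r := t.toReal
    have hiff : ∀ᵐ η ∂ω, IsFiniteRatio Γ η r ↔
        ∀ ε : ℝ, 0 < ε → IsRecurrent η α {a | |a - r| < ε} :=
      hq.mono fun η h => isFiniteRatio_iff_isRecurrent hαm hpos h.2.2 r
    rw [isFiniteRatio_iff_isRecurrent hαm hpos hνα, Filter.eventually_congr hiff]
    constructor
    · intro h
      -- Countably many radii shrinking to `0` suffice. The shift by `2` keeps them at most `r / 2`,
      -- so the values lie between `r / 2` and `2 * r`.
      have hn : ∀ᵐ η ∂ω, ∀ n : ℕ, IsRecurrent η α {a | |a - r| < r / (n + 2)} := by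
        refine ae_all_iff.mpr fun n => ae_isRecurrent_of_join hαm hq
          (measurableSet_lt (by fun_prop) measurable_const) (c := r / 2) (C := 2 * r) (by positivity)
          (fun a ha => ?_) (h _ (by positivity))
        have hle : r / (n + 2) ≤ r / 2 := by gcongr; linarith [n.cast_nonneg (α := ℝ)]
        have := abs_lt.mp (lt_of_lt_of_le ha hle)
        constructor <;> linarith
      filter_upwards [hn] with η hη ε hε
      obtain ⟨n, hn⟩ := exists_nat_gt (r / ε)
      refine (hη n).mono fun a (ha : |a - r| < _) => show |a - r| < ε from lt_trans ha ?_
      rw [div_lt_iff₀ (by positivity)]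
      rw [div_lt_iff₀ hε] at hn
      nlinarith
    · exact fun h ε hε => isRecurrent_join_of_ae (h.mono fun η hη => hη ε hε)
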